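/- Let $b\ge 2$ be an integer, $\alpha_1,\alpha_2>0$ and $y\in\mathbb{R}$. Let $\{x\}=x-\lfloor x\rfloor-\frac12$ for $x\notin\mathbb{Z}$ and $\{x\}=0$ for $x\in\mathbb{Z}$, and consider the Lévy function and the translated Lévy function $$L_{\alpha_1}^{b}(x)=\sum_{i\ge1}\frac{\{b^ix\}}{b^{\alpha_1 i}},\qquad L_{\alpha_2}^{b,y}(x)=\sum_{i\ge1}\frac{\{b^i(x-y)\}}{b^{\alpha_2 i}}\qquad(x\in\mathbb{R}).$$ For a locally bounded $f:\mathbb{R}\to\mathbb{R}$ let $h_f(x_0)$ be its Hölder exponent at $x_0$, i.e. the supremum of the $\alpha\ge0$ for which there are $C,r>0$ and a polynomial $P$ of degree $<\alpha$ ($P=0$ if $\alpha=0$) with $|f(x)-P(x-x_0)|\le C|x-x_0|^{\alpha}$ whenever $|x-x_0|\le r$. The bivariate multifractal spectrum is $$\mathcal{D}(H_1,H_2)=\dim_H\bigl\{x\in\mathbb{R}:\ h_{L_{\alpha_1}^{b}}(x)=H_1,\ h_{L_{\alpha_2}^{b,y}}(x)=H_2\bigr\},$$ where $\dim_H$ is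 the Hausdorff dimension, with $\dim_H\emptyset=-\infty$. With $\|\cdot\|$ the distance to the nearest integer, let $$\Delta^b(y)=\sup\bigl\{\alpha\ge1:\ \|b^ny\|\le b^{-n(\alpha-1)}\text{ for infinitely many }n\bigr\}\in[1,\infty],$$ and let (with $\alpha_i/\infty=0$) $$K_{\alpha_1,\alpha_2}(y)=\Bigl[0,\tfrac{\alpha_1}{\Delta^b(y)}\Bigr]\times\Bigl[0,\tfrac{\alpha_2}{\Delta^b(y)}\Bigr]\ \cup\ \Bigl\{(H_1,H_2):\ H_1\in[0,\alpha_1],\ H_2=\tfrac{\alpha_2}{\alpha_1}H_1\Bigr\}.$$ Then for every $(H_1,H_2)\in\bigl([0,\alpha_1]\times[0,\alpha_2]\bigr)\setminus K_{\alpha_1,\alpha_2}(y)$, either $$\mathcal{D}(H_1,H_2)=\min\Bigl\{\frac{H_1}{\alpha_1},\frac{H_2}{\alpha_2}\Bigr\}\qquad\text{or}\qquad \mathcal{D}(H_1,H_2)=-\infty.$$ -/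

import Mathlib

open Set Filter Topology

noncomputable section

namespace LevyBivariate

/-- The `1`-periodic saw-tooth function: `x - ⌊x⌋ - 1/2` for non-integer `x`, and `0` at integers. -/
def sawtooth (x : ℝ) : ℝ :=
  open Classical in
  if ∃ k : ℤ, x = k then 0 else x - ⌊x⌋ - 1 / 2

/-- The Lévy function `∑_{i ≥ 1} {bⁱ x} / b^(α i)`. For `α > 0` and `b ≥ 2` the series converges
absolutely, its terms being bounded by those of a geometric series. -/
def levy (b : ℕ) (α : ℝ) (x : ℝ) : ℝ :=
  ∑' i : ℕ, sawtooth ((b : ℝ) ^ (i + 1) * x) / (b : ℝ) ^ (α * ((i + 1 : ℕ) : ℝ))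

/-- The Lévy function translated by `y`: `∑_{i ≥ 1} {bⁱ (x - y)} / b^(α i)`. -/
def levyShift (b : ℕ) (α y : ℝ) (x : ℝ) : ℝ :=
  ∑' i : ℕ, sawtooth ((b : ℝ) ^ (i + 1) * (x - y)) / (b : ℝ) ^ (α * ((i + 1 : ℕ) : ℝ))

/-- `f ∈ C^α(x₀)`: near `x₀`, `|f x - P (x - x₀)| ≤ C |x - x₀|^α` for a polynomial `P` of degree
`< α`. The degree condition says that all coefficients of index `≥ α` vanish; for `α = 0` it
forces `P = 0`, and then `f ∈ C^0(x₀)` says that `f` is bounded near `x₀`. -/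
def MemHolderAt (f : ℝ → ℝ) (α x₀ : ℝ) : Prop :=
  ∃ C > 0, ∃ r > 0, ∃ P : Polynomial ℝ,
    (∀ k : ℕ, α ≤ (k : ℝ) → P.coeff k = 0) ∧
    ∀ x ∈ Icc (x₀ - r) (x₀ + r), |f x - P.eval (x - x₀)| ≤ C * |x - x₀| ^ α

/-- The Hölder exponent `h_f(x₀) = sup {α ≥ 0 : f ∈ C^α(x₀)}`, possibly `+∞`. -/
def holderExponent (f : ℝ → ℝ) (x₀ : ℝ) : EReal :=
  sSup ((fun α : ℝ => (α : EReal)) '' {α : ℝ | 0 ≤ α ∧ MemHolderAt f α x₀})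

/-- The bivariate level set of the points where `f` and `g` have Hölder exponents `H₁`, `H₂`. -/
def levelSet (f g : ℝ → ℝ) (H₁ H₂ : ℝ) : Set ℝ :=
  {x : ℝ | holderExponent f x = (H₁ : EReal) ∧ holderExponent g x = (H₂ : EReal)}

/-- Hausdorff dimension with the convention that the empty set has dimension `-∞`. -/
def hausdorffDim (E : Set ℝ) : EReal :=
  open Classical in
  if E = ∅ then ⊥ else ((dimH E : ENNReal) : EReal)

/-- The bivariate multifractal spectrum of `(f, g)`. -/
def bivariateSpectrum (f g : ℝ → ℝ) (H₁ H₂ : ℝ) : EReal :=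
  hausdorffDim (levelSet f g H₁ H₂)

/-- Distance from `x` to the nearest integer. -/
def distInt (x : ℝ) : ℝ := |x - round x|

/-- `x` is `α`-approximable by `b`-adic rationals:
`‖bⁿ x‖ ≤ 1 / b^(n (α - 1))` for infinitely many `n`. -/
def Approximable (b : ℕ) (α x : ℝ) : Prop :=
  {n : ℕ | distInt ((b : ℝ) ^ n * x) ≤ 1 / (b : ℝ) ^ ((n : ℝ) * (α - 1))}.Infinite

/-- The `b`-adic approximation exponent `Δᵇ(x) ∈ [1, +∞]`. -/
def approxExponent (b : ℕ) (x : ℝ) : EReal :=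
  sSup ((fun α : ℝ => (α : EReal)) '' {α : ℝ | 1 ≤ α ∧ Approximable b α x})

/-- The region `K_{α₁,α₂}(y)`: the rectangle `[0, α₁/Δᵇ(y)] × [0, α₂/Δᵇ(y)]` (with `αᵢ/∞ = 0`)
together with the diagonal `H₂ = (α₂/α₁) H₁`, `0 ≤ H₁ ≤ α₁`. -/
def regionK (b : ℕ) (α₁ α₂ y : ℝ) : Set (ℝ × ℝ) :=
  {H : ℝ × ℝ | 0 ≤ H.1 ∧ (H.1 : EReal) ≤ (α₁ : EReal) / approxExponent b y ∧
      0 ≤ H.2 ∧ (H.2 : EReal) ≤ (α₂ : EReal) / approxExponent b y} ∪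
  {H : ℝ × ℝ | H.1 ∈ Icc 0 α₁ ∧ H.2 = α₂ / α₁ * H.1}

end LevyBivariate

end

open MeasureTheory

noncomputable section

namespace LevyBivariate

lemma distInt_le (x : ℝ) (k : ℤ) : distInt x ≤ |x - k| := round_le x k

lemma distInt_nonneg (x : ℝ) : 0 ≤ distInt x := abs_nonneg _

lemma distInt_le_half (x : ℝ) : distInt x ≤ 1 / 2 := abs_sub_round x

lemma distInt_add_le (x y : ℝ) : distInt (x + y) ≤ distInt x + distInt y := by
  refine (distInt_le _ (round x + round y)).trans ?_
  refine le_trans (le_of_eq ?_) (abs_add_le (x - round x) (y - round y))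
  push_cast; congr 1; ring

lemma distInt_neg (x : ℝ) : distInt (-x) = distInt x := by
  have key : ∀ z : ℝ, distInt (-z) ≤ distInt z := fun z => by
    refine (distInt_le _ (-round z)).trans (le_of_eq ?_)
    rw [distInt, ← abs_neg]; push_cast; congr 1; ring
  exact le_antisymm (key x) (by simpa using key (-x))

lemma distInt_sub_le (x y : ℝ) : distInt (x - y) ≤ distInt x + distInt y := by
  rw [sub_eq_add_neg, ← distInt_neg y]; exact distInt_add_le _ _

lemma distInt_pow_mul_le (b j : ℕ) (x : ℝ) :
    distInt ((b : ℝ) ^ j * x) ≤ (b : ℝ) ^ j * distInt x := by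
  refine (distInt_le _ ((b : ℤ) ^ j * round x)).trans (le_of_eq ?_)
  rw [distInt]; push_cast
  rw [← mul_sub, abs_mul, abs_of_nonneg (by positivity : (0 : ℝ) ≤ (b : ℝ) ^ j)]

lemma distInt_add_int (x : ℝ) (k : ℤ) : distInt (x + k) = distInt x := by
  have key : ∀ (z : ℝ) (k : ℤ), distInt (z + k) ≤ distInt z := fun z k => by
    refine (distInt_le _ (round z + k)).trans (le_of_eq ?_)
    rw [distInt]; push_cast; congr 1; ring
  refine le_antisymm (key x k) ?_
  simpa using key (x + k) (-k)

lemma measurable_distInt : Measurable distInt := by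
  refine (LipschitzWith.of_le_add fun x y => ?_).continuous.measurable
  have h1 := distInt_add_le y (x - y)
  have h2 := distInt_le (x - y) 0
  rw [add_sub_cancel] at h1
  rw [Int.cast_zero, sub_zero, ← Real.dist_eq] at h2
  linarith

lemma approx_bound_eq {b : ℕ} (hb : 2 ≤ b) (n : ℕ) (a : ℝ) :
    1 / (b : ℝ) ^ ((n : ℝ) * (a - 1)) = (b : ℝ) ^ n * (b : ℝ) ^ (-(n * a)) := by
  have hb0 : (0 : ℝ) < b := by positivity
  rw [← Real.rpow_natCast, ← Real.rpow_add hb0, one_div, ← Real.rpow_neg hb0.le]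
  congr 1; ring

lemma approximable_iff {b : ℕ} (hb : 2 ≤ b) (a x : ℝ) : Approximable b a x ↔
    {n : ℕ | distInt ((b : ℝ) ^ n * x) ≤ (b : ℝ) ^ n * (b : ℝ) ^ (-(n * a))}.Infinite := by
  simp only [Approximable, approx_bound_eq hb]

lemma approximable_iff_frequently {b : ℕ} (hb : 2 ≤ b) (a x : ℝ) : Approximable b a x ↔
    ∃ᶠ n : ℕ in atTop, distInt ((b : ℝ) ^ n * x) ≤ (b : ℝ) ^ n * (b : ℝ) ^ (-(n * a)) := by
  rw [approximable_iff hb, Nat.frequently_atTop_iff_infinite]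

lemma Approximable.mono {b : ℕ} (hb : 2 ≤ b) {a a' x : ℝ} (h : Approximable b a' x) (ha : a ≤ a') :
    Approximable b a x := by
  rw [approximable_iff_frequently hb] at h ⊢
  refine h.mono fun n hn => hn.trans ?_
  have : (1 : ℝ) ≤ b := by exact_mod_cast (by omega : 1 ≤ b)
  gcongr

lemma approximable_one (b : ℕ) (x : ℝ) : Approximable b 1 x := by
  have : ∀ n : ℕ, distInt ((b : ℝ) ^ n * x) ≤ 1 / (b : ℝ) ^ ((n : ℝ) * (1 - 1)) := fun n => by
    simp only [sub_self, mul_zero, Real.rpow_zero, div_one]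
    exact (distInt_le_half _).trans (by norm_num)
  simp only [Approximable, this, ofPred_true]
  exact infinite_univ

/-- `Δᵇ(x) = 1 / t`, read as `Δᵇ(x) = ∞` when `t = 0`. -/
def HasApproxExponent (b : ℕ) (x t : ℝ) : Prop :=
  ∀ a : ℝ, 1 ≤ a → (Approximable b a x → t * a ≤ 1) ∧ (t * a < 1 → Approximable b a x)

lemma sawtooth_int (k : ℤ) : sawtooth k = 0 := by
  rw [sawtooth, if_pos ⟨k, rfl⟩]

lemma sawtooth_of_floor {x : ℝ} {m : ℤ} (h1 : (m : ℝ) < x) (h2 : x < m + 1) :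
    sawtooth x = x - m - 1 / 2 := by
  have hf : ⌊x⌋ = m := Int.floor_eq_iff.2 ⟨h1.le, h2⟩
  rw [sawtooth, if_neg, hf]
  rintro ⟨k, rfl⟩
  have h3 : m < k := by exact_mod_cast h1
  have h4 : k < m + 1 := by exact_mod_cast h2
  omega

lemma abs_sawtooth_le (x : ℝ) : |sawtooth x| ≤ 1 / 2 := by
  by_cases h : ∃ k : ℤ, x = k
  · obtain ⟨k, rfl⟩ := h
    rw [sawtooth_int]; norm_num
  · have h1 : ((⌊x⌋ : ℤ) : ℝ) < x := lt_of_le_of_ne (Int.floor_le x) fun e => h ⟨_, e.symm⟩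
    have h2 := Int.lt_floor_add_one x
    rw [sawtooth_of_floor h1 h2, abs_le]
    constructor <;> linarith

lemma sawtooth_sub_of_close {x x' : ℝ} (h : |x' - x| < distInt x) :
    sawtooth x' - sawtooth x = x' - x := by
  have h1 := distInt_le x ⌊x⌋
  have h2 := distInt_le x (⌊x⌋ + 1)
  have h3 := Int.floor_le x
  have h4 := Int.lt_floor_add_one x
  push_cast at h2
  rw [abs_of_nonneg (by linarith)] at h1
  rw [abs_of_nonpos (by linarith)] at h2
  have h5 := abs_lt.1 h
  have h0 := abs_nonneg (x' - x)
  rw [sawtooth_of_floor (m := ⌊x⌋) (x := x) (by linarith) (by linarith),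
    sawtooth_of_floor (m := ⌊x⌋) (x := x') (by linarith) (by linarith)]
  ring

/-- The symmetric increment of the saw-tooth function at `x` tends to `-1` if `x` is an integer and
to `0` otherwise. -/
lemma tendsto_sawtooth_jump (x c : ℝ) (hc : 0 < c) :
    Tendsto (fun u => sawtooth (x + c * u) - sawtooth (x - c * u)) (𝓝[>] 0)
      (𝓝 (if distInt x = 0 then -1 else 0)) := by
  split_ifs with h
  · have hx : x = round x := by
      rw [distInt, abs_eq_zero, sub_eq_zero] at h; exact h
    have hev : ∀ᶠ u : ℝ in 𝓝[>] 0, 2 * c * u - 1 =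
        sawtooth (x + c * u) - sawtooth (x - c * u) := by
      filter_upwards [Ioo_mem_nhdsGT (show (0 : ℝ) < 1 / c by positivity)] with u hu
      have h1 : 0 < c * u := mul_pos hc hu.1
      have h2 : c * u < 1 := by
        have := hu.2
        rwa [lt_div_iff₀ hc, mul_comm] at this
      rw [sawtooth_of_floor (m := round x) (by linarith) (by linarith),
        sawtooth_of_floor (m := round x - 1) (by push_cast; linarith) (by push_cast; linarith)]
      push_cast; ring
    refine Tendsto.congr' hev ?_
    have : Tendsto (fun u : ℝ => 2 * c * u - 1) (𝓝 0) (𝓝 (2 * c * 0 - 1)) := by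
      apply Continuous.tendsto; fun_prop
    simpa using this.mono_left nhdsWithin_le_nhds
  · have hd : 0 < distInt x := lt_of_le_of_ne (distInt_nonneg x) (Ne.symm h)
    have hev : ∀ᶠ u : ℝ in 𝓝[>] 0, 2 * c * u =
        sawtooth (x + c * u) - sawtooth (x - c * u) := by
      filter_upwards [Ioo_mem_nhdsGT (show (0 : ℝ) < distInt x / c by positivity)] with u hu
      have h1 : 0 < c * u := mul_pos hc hu.1
      have h2 : c * u < distInt x := by
        have := hu.2
        rwa [lt_div_iff₀ hc, mul_comm] at this
      have e1 := sawtooth_sub_of_close (x := x) (x' := x + c * u)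
        (by rw [add_sub_cancel_left, abs_of_pos h1]; exact h2)
      have e2 := sawtooth_sub_of_close (x := x) (x' := x - c * u)
        (by rw [sub_sub_cancel_left, abs_neg, abs_of_pos h1]; exact h2)
      linarith
    refine Tendsto.congr' hev ?_
    have : Tendsto (fun u : ℝ => 2 * c * u) (𝓝 0) (𝓝 (2 * c * 0)) := by
      apply Continuous.tendsto; fun_prop
    simpa using this.mono_left nhdsWithin_le_nhds

lemma levy_weight_eq (b : ℕ) (α : ℝ) (i : ℕ) :
    ((b : ℝ) ^ (α * ((i + 1 : ℕ) : ℝ)))⁻¹ = (b : ℝ) ^ (-(α * ((i + 1 : ℕ) : ℝ))) := by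
  rw [Real.rpow_neg (by positivity)]

lemma summable_rpow_neg {b : ℕ} (hb : 2 ≤ b) {β : ℝ} (hβ : 0 < β) :
    Summable fun i : ℕ => (b : ℝ) ^ (-(β * (i : ℝ))) := by
  have hb1 : (1 : ℝ) < b := by exact_mod_cast hb
  have : (fun i : ℕ => (b : ℝ) ^ (-(β * (i : ℝ)))) = fun i : ℕ => ((b : ℝ) ^ (-β)) ^ i := by
    funext i
    rw [← Real.rpow_natCast, ← Real.rpow_mul (by positivity)]
    congr 1; ring
  rw [this]
  exact summable_geometric_of_lt_one (by positivity)
    (Real.rpow_lt_one_of_one_lt_of_neg hb1 (by linarith))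

lemma summable_levy_weight {b : ℕ} (hb : 2 ≤ b) {β : ℝ} (hβ : 0 < β) :
    Summable fun i : ℕ => (b : ℝ) ^ (-(β * ((i + 1 : ℕ) : ℝ))) :=
  (summable_nat_add_iff 1).2 (summable_rpow_neg hb hβ)

lemma abs_levy_term_le (b : ℕ) (α x : ℝ) (i : ℕ) :
    |sawtooth ((b : ℝ) ^ (i + 1) * x) / (b : ℝ) ^ (α * ((i + 1 : ℕ) : ℝ))| ≤
      (b : ℝ) ^ (-(α * ((i + 1 : ℕ) : ℝ))) := by
  have h0 : (0 : ℝ) ≤ (b : ℝ) ^ (-(α * ((i + 1 : ℕ) : ℝ))) := by positivity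
  rw [div_eq_mul_inv, levy_weight_eq, abs_mul, abs_of_nonneg h0]
  refine mul_le_of_le_one_left h0 ((abs_sawtooth_le _).trans (by norm_num))

lemma summable_levy_term {b : ℕ} (hb : 2 ≤ b) {α : ℝ} (hα : 0 < α) (x : ℝ) :
    Summable fun i : ℕ =>
      sawtooth ((b : ℝ) ^ (i + 1) * x) / (b : ℝ) ^ (α * ((i + 1 : ℕ) : ℝ)) :=
  Summable.of_norm_bounded (summable_levy_weight hb hα) fun i => abs_levy_term_le b α x i

lemma exists_abs_levy_le {b : ℕ} (hb : 2 ≤ b) {α : ℝ} (hα : 0 < α) :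
    ∃ C > 0, ∀ x, |levy b α x| ≤ C := by
  refine ⟨∑' i : ℕ, (b : ℝ) ^ (-(α * ((i + 1 : ℕ) : ℝ))) + 1, ?_, fun x => ?_⟩
  · have : 0 ≤ ∑' i : ℕ, (b : ℝ) ^ (-(α * ((i + 1 : ℕ) : ℝ))) :=
      tsum_nonneg fun i => by positivity
    linarith
  · have : |levy b α x| ≤ ∑' i : ℕ, (b : ℝ) ^ (-(α * ((i + 1 : ℕ) : ℝ))) := by
      rw [levy, ← Real.norm_eq_abs]
      exact tsum_of_norm_bounded (summable_levy_weight hb hα).hasSum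
        fun i => (Real.norm_eq_abs _).trans_le (abs_levy_term_le b α x i)
    linarith

/-- At a point `q` with `bⁿ q ∈ ℤ`, the Lévy function has a downward jump of size at least
`b^(-α n)`. -/
lemma exists_levy_jump {b : ℕ} (hb : 2 ≤ b) {α : ℝ} (hα : 0 < α) {q : ℝ} {n : ℕ} (hn : 1 ≤ n)
    (hq : distInt ((b : ℝ) ^ n * q) = 0) :
    ∃ J : ℝ, J ≤ -(b : ℝ) ^ (-(α * n)) ∧
      Tendsto (fun u => levy b α (q + u) - levy b α (q - u)) (𝓝[>] 0) (𝓝 J) := by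
  have hb0 : (0 : ℝ) < b := by positivity
  set w : ℕ → ℝ := fun i => (b : ℝ) ^ (-(α * ((i + 1 : ℕ) : ℝ))) with hw
  have hw0 : ∀ i, 0 < w i := fun i => by positivity
  have hws : Summable w := summable_levy_weight hb hα
  set j : ℕ → ℝ := fun i => (if distInt ((b : ℝ) ^ (i + 1) * q) = 0 then -1 else 0) * w i with hj
  have hj0 : ∀ i, j i ≤ 0 := fun i => by
    simp only [hj]; split_ifs
    · have := hw0 i; linarith
    · simp
  have hjs : Summable j := by
    refine Summable.of_norm_bounded hws fun i => ?_
    simp only [hj]; split_ifs <;> simp [abs_of_pos (hw0 i), (hw0 i).le]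
  refine ⟨∑' i, j i, ?_, ?_⟩
  · have hjn : j (n - 1) = -(b : ℝ) ^ (-(α * n)) := by
      simp only [hj, hw, Nat.sub_add_cancel hn, hq, if_true]; ring
    rw [← hjn]
    have := hjs.neg.le_tsum (n - 1) fun i _ => by have := hj0 i; linarith
    rw [tsum_neg] at this
    linarith
  · have heq : (fun u => levy b α (q + u) - levy b α (q - u)) = fun u => ∑' i : ℕ,
        (sawtooth ((b : ℝ) ^ (i + 1) * q + (b : ℝ) ^ (i + 1) * u) -
          sawtooth ((b : ℝ) ^ (i + 1) * q - (b : ℝ) ^ (i + 1) * u)) * w i := by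
      funext u
      rw [levy, levy, ← (summable_levy_term hb hα _).tsum_sub (summable_levy_term hb hα _)]
      refine tsum_congr fun i => ?_
      rw [div_eq_mul_inv, div_eq_mul_inv, levy_weight_eq, mul_add, mul_sub, ← sub_mul]
    rw [heq]
    refine tendsto_tsum_of_dominated_convergence hws (fun i => ?_) ?_
    · exact (tendsto_sawtooth_jump _ _ (by positivity)).mul_const _
    · refine Eventually.of_forall fun u i => ?_
      rw [norm_mul, Real.norm_eq_abs, Real.norm_eq_abs, abs_of_pos (hw0 i)]
      refine mul_le_of_le_one_left (hw0 i).le ((abs_sub _ _).trans ?_)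
      have h1 := abs_sawtooth_le ((b : ℝ) ^ (i + 1) * q + (b : ℝ) ^ (i + 1) * u)
      have h2 := abs_sawtooth_le ((b : ℝ) ^ (i + 1) * q - (b : ℝ) ^ (i + 1) * u)
      linarith

lemma levy_jump_le_of_holder {f : ℝ → ℝ} {h x₀ C r q J : ℝ} {P : Polynomial ℝ} (hh : 0 < h)
    (hP : ∀ x ∈ Icc (x₀ - r) (x₀ + r), |f x - P.eval (x - x₀)| ≤ C * |x - x₀| ^ h)
    (hq : |q - x₀| < r)
    (hJ : Tendsto (fun u => f (q + u) - f (q - u)) (𝓝[>] 0) (𝓝 J)) :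
    |J| ≤ 2 * C * |q - x₀| ^ h := by
  set F : ℝ → ℝ := fun u => C * |q + u - x₀| ^ h + C * |q - u - x₀| ^ h +
    |P.eval (q + u - x₀) - P.eval (q - u - x₀)| with hF
  have hFc : Continuous F := by
    have h1 : Continuous fun u : ℝ => |q + u - x₀| ^ h :=
      (by fun_prop : Continuous fun u : ℝ => |q + u - x₀|).rpow_const fun _ => Or.inr hh.le
    have h2 : Continuous fun u : ℝ => |q - u - x₀| ^ h :=
      (by fun_prop : Continuous fun u : ℝ => |q - u - x₀|).rpow_const fun _ => Or.inr hh.le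
    have h3 : Continuous fun u : ℝ => P.eval (q + u - x₀) := P.continuous.comp (by fun_prop)
    have h4 : Continuous fun u : ℝ => P.eval (q - u - x₀) := P.continuous.comp (by fun_prop)
    exact ((continuous_const.mul h1).add (continuous_const.mul h2)).add (h3.sub h4).abs
  have hF0 : F 0 = 2 * C * |q - x₀| ^ h := by
    simp only [hF, add_zero, sub_zero, sub_self, abs_zero]; ring
  rw [← hF0]
  refine le_of_tendsto_of_tendsto hJ.abs ((hFc.tendsto 0).mono_left nhdsWithin_le_nhds) ?_
  have hq' := abs_lt.1 hq
  filter_upwards [Ioo_mem_nhdsGT (show (0 : ℝ) < r - |q - x₀| by linarith)] with u hu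
  have h0 := neg_abs_le (q - x₀)
  have h1 := le_abs_self (q - x₀)
  have e1 := hP (q + u) ⟨by linarith [hu.1, hu.2], by linarith [hu.1, hu.2]⟩
  have e2 := hP (q - u) ⟨by linarith [hu.1, hu.2], by linarith [hu.1, hu.2]⟩
  have e3 : f (q + u) - f (q - u) = (f (q + u) - P.eval (q + u - x₀)) +
    (P.eval (q + u - x₀) - P.eval (q - u - x₀)) - (f (q - u) - P.eval (q - u - x₀)) := by ring
  rw [e3]
  refine (abs_sub _ _).trans ?_
  have := abs_add_le (f (q + u) - P.eval (q + u - x₀))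
    (P.eval (q + u - x₀) - P.eval (q - u - x₀))
  simp only [hF]; linarith

lemma tendsto_rpow_neg_mul {b : ℕ} (hb : 2 ≤ b) {β : ℝ} (hβ : 0 < β) :
    Tendsto (fun n : ℕ => (b : ℝ) ^ (-(β * n))) atTop (𝓝 0) :=
  (summable_rpow_neg hb hβ).tendsto_atTop_zero

theorem mul_le_of_memHolderAt_levy {b : ℕ} (hb : 2 ≤ b) {α : ℝ} (hα : 0 < α) {h a x : ℝ}
    (hh : 0 < h) (ha : 1 ≤ a) (hmem : MemHolderAt (levy b α) h x) (happ : Approximable b a x) :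
    h * a ≤ α := by
  obtain ⟨C, hC, r, hr, P, -, hP⟩ := hmem
  have hb0 : (0 : ℝ) < b := by positivity
  by_contra! hlt
  rw [approximable_iff_frequently hb] at happ
  have ev1 : ∀ᶠ n : ℕ in atTop, (b : ℝ) ^ (-(a * n)) < r :=
    (tendsto_rpow_neg_mul hb (by linarith)).eventually (gt_mem_nhds hr)
  have ev2 : ∀ᶠ n : ℕ in atTop, (b : ℝ) ^ (-((h * a - α) * n)) < 1 / (2 * C) :=
    (tendsto_rpow_neg_mul hb (by linarith)).eventually (gt_mem_nhds (by positivity))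
  obtain ⟨n, hn, h1, h2, h3⟩ :=
    (happ.and_eventually (ev1.and (ev2.and (eventually_ge_atTop 1)))).exists
  set q : ℝ := round ((b : ℝ) ^ n * x) / (b : ℝ) ^ n with hq
  have hbn : (0 : ℝ) < (b : ℝ) ^ n := by positivity
  have hbq : (b : ℝ) ^ n * q = round ((b : ℝ) ^ n * x) := by rw [hq]; field_simp
  have hq0 : distInt ((b : ℝ) ^ n * q) = 0 := by rw [hbq, distInt, round_intCast, sub_self, abs_zero]
  have hqx : |q - x| ≤ (b : ℝ) ^ (-(a * n)) := by
    have : (b : ℝ) ^ n * |q - x| = distInt ((b : ℝ) ^ n * x) := by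
      rw [distInt, ← hbq, ← mul_sub, abs_mul, abs_of_pos hbn, abs_sub_comm]
    rw [← this, mul_comm (n : ℝ)] at hn
    exact le_of_mul_le_mul_left hn hbn
  obtain ⟨J, hJ, hJt⟩ := exists_levy_jump hb hα h3 hq0
  have hJle := levy_jump_le_of_holder hh hP (hqx.trans_lt h1) hJt
  have hJ' : (b : ℝ) ^ (-(α * n)) ≤ |J| := by
    have := neg_le_abs J; linarith
  have h4 : |q - x| ^ h ≤ (b : ℝ) ^ (-(a * n) * h) := by
    rw [Real.rpow_mul hb0.le]
    exact Real.rpow_le_rpow (abs_nonneg _) hqx hh.le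
  have h5 : (b : ℝ) ^ (-(a * n) * h) = (b : ℝ) ^ (-((h * a - α) * n)) * (b : ℝ) ^ (-(α * n)) := by
    rw [← Real.rpow_add hb0]; congr 1; ring
  have h6 : (0 : ℝ) < (b : ℝ) ^ (-(α * n)) := by positivity
  have h7 : 2 * C * |q - x| ^ h < (b : ℝ) ^ (-(α * n)) := by
    calc 2 * C * |q - x| ^ h ≤ 2 * C * ((b : ℝ) ^ (-((h * a - α) * n)) * (b : ℝ) ^ (-(α * n))) := by
          rw [← h5]; gcongr
      _ < 2 * C * (1 / (2 * C) * (b : ℝ) ^ (-(α * n))) := by gcongr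
      _ = (b : ℝ) ^ (-(α * n)) := by field_simp
  linarith

lemma abs_sawtooth_increment_le {b N : ℕ} (hb : 2 ≤ b) {a h κ x x' : ℝ} (ha : 1 ≤ a)
    (hκ : κ = 0 ∧ 0 < h ∧ h ≤ 1 ∨ κ = 1 ∧ 1 ≤ h)
    (hclose : |x' - x| ≤ (b : ℝ) ^ (-(a * N)) →
      (b : ℝ) ^ N * |x' - x| < distInt ((b : ℝ) ^ N * x)) :
    |sawtooth ((b : ℝ) ^ N * x') - sawtooth ((b : ℝ) ^ N * x) - κ * ((b : ℝ) ^ N * (x' - x))| ≤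
      2 * ((b : ℝ) ^ (a * N) * |x' - x|) ^ h := by
  have hb0 : (0 : ℝ) < b := by positivity
  have hb1 : (1 : ℝ) ≤ b := by exact_mod_cast (by omega : 1 ≤ b)
  have hh : 0 ≤ h := by rcases hκ with h | h <;> linarith
  set d := |x' - x| with hd
  have hd0 : 0 ≤ d := abs_nonneg _
  have hle : (b : ℝ) ^ N * d ≤ (b : ℝ) ^ (a * N) * d := by
    rw [← Real.rpow_natCast]
    gcongr
    have : (0 : ℝ) ≤ N := by positivity
    nlinarith
  have habs : |(b : ℝ) ^ N * (x' - x)| = (b : ℝ) ^ N * d := by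
    rw [abs_mul, abs_of_pos (by positivity)]
  by_cases hc : d ≤ (b : ℝ) ^ (-(a * N))
  · have hlt := hclose hc
    rw [sawtooth_sub_of_close (by rw [← mul_sub, habs]; exact hlt), ← mul_sub]
    rcases hκ with ⟨rfl, h1, h2⟩ | ⟨rfl, h1⟩
    · rw [zero_mul, sub_zero, habs]
      have h3 : (b : ℝ) ^ N * d ≤ 1 := by
        have := distInt_le_half ((b : ℝ) ^ N * x); linarith
      calc (b : ℝ) ^ N * d ≤ ((b : ℝ) ^ N * d) ^ h :=
            Real.self_le_rpow_of_le_one (by positivity) h3 h2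
        _ ≤ ((b : ℝ) ^ (a * N) * d) ^ h := Real.rpow_le_rpow (by positivity) hle hh
        _ ≤ 2 * ((b : ℝ) ^ (a * N) * d) ^ h := by
          have : 0 ≤ ((b : ℝ) ^ (a * N) * d) ^ h := by positivity
          linarith
    · rw [one_mul, sub_self, abs_zero]; positivity
  · have h1 : 1 ≤ (b : ℝ) ^ (a * N) * d := by
      rw [Real.rpow_neg hb0.le, not_le, inv_eq_one_div, div_lt_iff₀ (by positivity)] at hc
      linarith
    have h2 : 1 ≤ ((b : ℝ) ^ (a * N) * d) ^ h := Real.one_le_rpow h1 hh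
    have h3 := abs_sub (sawtooth ((b : ℝ) ^ N * x')) (sawtooth ((b : ℝ) ^ N * x))
    have h4 := abs_sawtooth_le ((b : ℝ) ^ N * x')
    have h5 := abs_sawtooth_le ((b : ℝ) ^ N * x)
    rcases hκ with ⟨rfl, -, -⟩ | ⟨rfl, h6⟩
    · rw [zero_mul, sub_zero]; linarith
    · refine (abs_sub _ _).trans ?_
      rw [one_mul, habs]
      have h7 : (b : ℝ) ^ (a * N) * d ≤ ((b : ℝ) ^ (a * N) * d) ^ h :=
        Real.self_le_rpow_of_one_le h1 h6
      linarith

lemma exists_forall_distInt_gt {b : ℕ} (hb : 2 ≤ b) {a x : ℝ}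
    (happ : ¬ Approximable b a x) :
    ∃ r > 0, ∀ (d : ℝ) (N : ℕ), d ≤ r → d ≤ (b : ℝ) ^ (-(a * N)) →
      (b : ℝ) ^ N * d < distInt ((b : ℝ) ^ N * x) := by
  have hb0 : (0 : ℝ) < b := by positivity
  have hb1 : (1 : ℝ) ≤ b := by exact_mod_cast (by omega : 1 ≤ b)
  rw [approximable_iff_frequently hb, not_frequently, eventually_atTop] at happ
  obtain ⟨n₀, hn₀⟩ := happ
  refine ⟨(b : ℝ) ^ (-(a * n₀)), by positivity, fun d N hd1 hd2 => ?_⟩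
  have hM : ∃ M : ℕ, N ≤ M ∧ n₀ ≤ M ∧ d ≤ (b : ℝ) ^ (-(a * M)) := by
    rcases le_total N n₀ with h | h
    · exact ⟨n₀, h, le_rfl, hd1⟩
    · exact ⟨N, le_rfl, h, hd2⟩
  obtain ⟨M, hNM, hnM, hdM⟩ := hM
  have h1 := not_le.1 (hn₀ M hnM)
  have h2 := distInt_pow_mul_le b (M - N) ((b : ℝ) ^ N * x)
  have h3 : (b : ℝ) ^ M = (b : ℝ) ^ (M - N) * (b : ℝ) ^ N := by
    rw [← pow_add, Nat.sub_add_cancel hNM]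
  rw [← mul_assoc, ← h3] at h2
  have h4 : (b : ℝ) ^ (M - N) * ((b : ℝ) ^ N * d) <
      (b : ℝ) ^ (M - N) * distInt ((b : ℝ) ^ N * x) := by
    refine lt_of_le_of_lt ?_ (h1.trans_le h2)
    rw [← mul_assoc, ← h3, mul_comm (M : ℝ)]
    gcongr
  exact lt_of_mul_lt_mul_left h4 (by positivity)

theorem memHolderAt_levy_zero {b : ℕ} (hb : 2 ≤ b) {α : ℝ} (hα : 0 < α) (x : ℝ) :
    MemHolderAt (levy b α) 0 x := by
  obtain ⟨C, hC, hf⟩ := exists_abs_levy_le hb hα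
  exact ⟨C, hC, 1, one_pos, 0, fun k _ => Polynomial.coeff_zero k, fun z _ => by simpa using hf z⟩

theorem memHolderAt_levy {b : ℕ} (hb : 2 ≤ b) {α : ℝ} (hα : 0 < α) {h a x : ℝ}
    (hh : 0 ≤ h) (ha : 1 ≤ a) (happ : ¬ Approximable b a x) (hlt : h * a < α) :
    MemHolderAt (levy b α) h x := by
  rcases hh.eq_or_lt with rfl | hh
  · exact memHolderAt_levy_zero hb hα x
  have hb0 : (0 : ℝ) < b := by positivity
  obtain ⟨r, hr, hclose⟩ := exists_forall_distInt_gt hb happ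
  obtain ⟨κ, hκ, hcoef⟩ : ∃ κ : ℝ, (κ = 0 ∧ 0 < h ∧ h ≤ 1 ∨ κ = 1 ∧ 1 ≤ h) ∧
      ∀ k : ℕ, h ≤ k → k ≠ 0 ∧ (κ ≠ 0 → k ≠ 1) := by
    rcases le_or_gt h 1 with h1 | h1
    · refine ⟨0, Or.inl ⟨rfl, hh, h1⟩, fun k hk => ⟨?_, fun h => absurd rfl h⟩⟩
      rintro rfl; simp only [Nat.cast_zero] at hk; linarith
    · refine ⟨1, Or.inr ⟨rfl, h1.le⟩, fun k hk => ⟨?_, fun _ => ?_⟩⟩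
      · rintro rfl; simp only [Nat.cast_zero] at hk; linarith
      · rintro rfl; simp only [Nat.cast_one] at hk; linarith
  set w : ℕ → ℝ := fun i => (b : ℝ) ^ (-(α * ((i + 1 : ℕ) : ℝ))) with hw
  have hw0 : ∀ i, 0 < w i := fun i => by positivity
  have hS : Summable fun i : ℕ => κ * ((b : ℝ) ^ (i + 1) * w i) := by
    rcases hκ with ⟨rfl, -, -⟩ | ⟨rfl, h1⟩
    · simp
    · have hα1 : 0 < α - 1 := by nlinarith
      refine (summable_levy_weight hb hα1).congr fun i => ?_
      simp only [hw]
      rw [one_mul, ← Real.rpow_natCast, ← Real.rpow_add hb0]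
      congr 1; ring
  have hβ : 0 < α - h * a := by linarith
  set V : ℕ → ℝ := fun i => (b : ℝ) ^ (-((α - h * a) * ((i + 1 : ℕ) : ℝ))) with hV
  have hVs : Summable V := summable_levy_weight hb hβ
  have hV0 : 0 ≤ ∑' i, V i := tsum_nonneg fun i => by positivity
  set S := ∑' i : ℕ, κ * ((b : ℝ) ^ (i + 1) * w i) with hSdef
  refine ⟨2 * ∑' i, V i + 1, by linarith, r, hr,
    Polynomial.C (levy b α x) + Polynomial.C S * Polynomial.X, fun k hk => ?_, fun x' hx' => ?_⟩
  · obtain ⟨k0, k1⟩ := hcoef k hk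
    rw [Polynomial.coeff_add, Polynomial.coeff_C, if_neg k0, Polynomial.coeff_C_mul,
      Polynomial.coeff_X, zero_add]
    by_cases hκ0 : κ = 0
    · simp [hSdef, hκ0]
    · rw [if_neg (Ne.symm (k1 hκ0)), mul_zero]
  · have hd : |x' - x| ≤ r := abs_le.2 ⟨by linarith [hx'.1], by linarith [hx'.2]⟩
    have hsum : levy b α x' - (Polynomial.C (levy b α x) + Polynomial.C S * Polynomial.X).eval
        (x' - x) = ∑' i : ℕ, (sawtooth ((b : ℝ) ^ (i + 1) * x') - sawtooth ((b : ℝ) ^ (i + 1) * x)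
          - κ * ((b : ℝ) ^ (i + 1) * (x' - x))) * w i := by
      have e1 := summable_levy_term hb hα x'
      have e2 := summable_levy_term hb hα x
      have e3 := hS.mul_right (x' - x)
      simp only [Polynomial.eval_add, Polynomial.eval_C, Polynomial.eval_mul, Polynomial.eval_X]
      rw [hSdef, ← tsum_mul_right, levy, levy, ← sub_sub, ← e1.tsum_sub e2, ← (e1.sub e2).tsum_sub e3]
      refine tsum_congr fun i => ?_
      rw [div_eq_mul_inv, div_eq_mul_inv, levy_weight_eq]
      ring
    rw [hsum]
    have hbound : ∀ i : ℕ, ‖(sawtooth ((b : ℝ) ^ (i + 1) * x') -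
        sawtooth ((b : ℝ) ^ (i + 1) * x) - κ * ((b : ℝ) ^ (i + 1) * (x' - x))) * w i‖ ≤
        V i * (2 * |x' - x| ^ h) := fun i => by
      rw [norm_mul, Real.norm_eq_abs, Real.norm_eq_abs, abs_of_pos (hw0 i)]
      refine (mul_le_mul_of_nonneg_right (abs_sawtooth_increment_le hb ha hκ
        fun hc => hclose _ _ hd hc) (hw0 i).le).trans (le_of_eq ?_)
      rw [Real.mul_rpow (by positivity) (abs_nonneg _), ← Real.rpow_mul hb0.le]
      have : (b : ℝ) ^ (a * ((i + 1 : ℕ) : ℝ) * h) * w i = V i := by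
        simp only [hw, hV]
        rw [← Real.rpow_add hb0]; congr 1; ring
      rw [← this]; ring
    have hb' := tsum_of_norm_bounded (hVs.mul_right (2 * |x' - x| ^ h)).hasSum hbound
    rw [Real.norm_eq_abs, tsum_mul_right] at hb'
    refine hb'.trans ?_
    have : 0 ≤ |x' - x| ^ h := by positivity
    nlinarith

theorem holderExponent_levy_eq_iff {b : ℕ} (hb : 2 ≤ b) {α : ℝ} (hα : 0 < α) {H : ℝ}
    (hH : H ∈ Icc 0 α) (x : ℝ) :
    holderExponent (levy b α) x = (H : EReal) ↔ HasApproxExponent b x (H / α) := by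
  have hα' := hα.ne'
  constructor
  · intro hx a ha
    have hle : ∀ h : ℝ, 0 ≤ h → MemHolderAt (levy b α) h x → h ≤ H := fun h h0 hm => by
      have : (h : EReal) ≤ H := by
        rw [← hx]; exact le_sSup ⟨h, ⟨h0, hm⟩, rfl⟩
      exact_mod_cast this
    have ha0 : 0 < a := by linarith
    constructor
    · intro happ
      have : (H : EReal) ≤ ((α / a : ℝ) : EReal) := by
        rw [← hx]
        refine sSup_le ?_
        rintro _ ⟨h, ⟨h0, hm⟩, rfl⟩
        refine EReal.coe_le_coe_iff.2 ?_
        rcases h0.eq_or_lt with rfl | h0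
        · positivity
        · rw [le_div_iff₀ ha0]
          exact mul_le_of_memHolderAt_levy hb hα h0 ha hm happ
      have := EReal.coe_le_coe_iff.1 this
      rw [le_div_iff₀ ha0] at this
      rw [div_mul_eq_mul_div, div_le_one hα]
      exact this
    · intro hlt
      by_contra hna
      rw [div_mul_eq_mul_div, div_lt_one hα, ← lt_div_iff₀ ha0] at hlt
      obtain ⟨h, h1, h2⟩ := exists_between hlt
      have := hle h (hH.1.trans h1.le)
        (memHolderAt_levy hb hα (hH.1.trans h1.le) ha hna ((lt_div_iff₀ ha0).1 h2))
      linarith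
  · intro hx
    refine le_antisymm (sSup_le ?_) ?_
    · rintro _ ⟨h, ⟨h0, hm⟩, rfl⟩
      refine EReal.coe_le_coe_iff.2 ?_
      by_contra! hlt
      have hpos : 0 < h := hH.1.trans_lt hlt
      have h1 : h * 1 ≤ α := mul_le_of_memHolderAt_levy hb hα hpos le_rfl hm (approximable_one b x)
      obtain ⟨h', h2, h3⟩ := exists_between hlt
      have h'0 : 0 < h' := hH.1.trans_lt h2
      have ha : 1 ≤ α / h' := by rw [le_div_iff₀ h'0]; linarith
      have happ := (hx _ ha).2 (by
        rw [div_mul_div_comm, mul_comm α h', mul_div_mul_right _ _ hα', div_lt_one h'0]; exact h2)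
      have := mul_le_of_memHolderAt_levy hb hα hpos ha hm happ
      rw [← mul_div_assoc, div_le_iff₀ h'0] at this
      nlinarith
    · have h0mem : (0 : EReal) ≤ holderExponent (levy b α) x :=
        le_sSup ⟨0, ⟨le_rfl, memHolderAt_levy_zero hb hα x⟩, rfl⟩
      refine le_of_forall_lt fun c hc => ?_
      by_contra! hle
      have hc0 : (0 : EReal) ≤ c := h0mem.trans hle
      lift c to ℝ using ⟨(hc.trans (EReal.coe_lt_top H)).ne,
        fun h => by rw [h] at hc0; exact absurd hc0 (by simp)⟩
      have hcH : c < H := EReal.coe_lt_coe_iff.1 hc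
      have hc0' : 0 ≤ c := by exact_mod_cast hc0
      obtain ⟨h, h1, h2⟩ := exists_between hcH
      obtain ⟨h', h3, h4⟩ := exists_between h2
      have h'0 : 0 < h' := by linarith
      have ha : 1 ≤ α / h' := by rw [le_div_iff₀ h'0]; linarith [hH.2]
      have hna : ¬ Approximable b (α / h') x := fun happ => by
        have := (hx _ ha).1 happ
        rw [div_mul_div_comm, mul_comm α h', mul_div_mul_right _ _ hα', div_le_one h'0] at this
        linarith
      have hm := memHolderAt_levy hb hα (h := h) (by linarith) ha hna (by
        rw [← mul_div_assoc, div_lt_iff₀ h'0]; nlinarith)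
      have hle' : (h : EReal) ≤ holderExponent (levy b α) x :=
        le_sSup ⟨h, ⟨by linarith, hm⟩, rfl⟩
      have := EReal.coe_le_coe_iff.1 (hle'.trans hle)
      linarith

lemma memHolderAt_comp_sub {f : ℝ → ℝ} {h x y : ℝ} (hm : MemHolderAt f h (x - y)) :
    MemHolderAt (fun z => f (z - y)) h x := by
  obtain ⟨C, hC, r, hr, P, hP, hf⟩ := hm
  refine ⟨C, hC, r, hr, P, hP, fun z hz => ?_⟩
  have := hf (z - y) ⟨by linarith [hz.1], by linarith [hz.2]⟩
  rwa [sub_sub_sub_cancel_right] at this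

lemma holderExponent_comp_sub (f : ℝ → ℝ) (x y : ℝ) :
    holderExponent (fun z => f (z - y)) x = holderExponent f (x - y) := by
  have : ∀ h, MemHolderAt (fun z => f (z - y)) h x ↔ MemHolderAt f h (x - y) := fun h => by
    refine ⟨fun hm => ?_, memHolderAt_comp_sub⟩
    have := memHolderAt_comp_sub (f := fun z => f (z - y)) (h := h) (x := x - y) (y := -y)
      (by rwa [sub_neg_eq_add, sub_add_cancel])
    simpa only [sub_neg_eq_add, add_sub_cancel_right] using this
  simp only [holderExponent, this]

theorem levelSet_levy_eq {b : ℕ} (hb : 2 ≤ b) {α₁ α₂ : ℝ} (hα₁ : 0 < α₁) (hα₂ : 0 < α₂) (y : ℝ)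
    {H₁ H₂ : ℝ} (h₁ : H₁ ∈ Icc 0 α₁) (h₂ : H₂ ∈ Icc 0 α₂) :
    levelSet (levy b α₁) (levyShift b α₂ y) H₁ H₂ =
      {x | HasApproxExponent b x (H₁ / α₁) ∧ HasApproxExponent b (x - y) (H₂ / α₂)} := by
  ext x
  have : levyShift b α₂ y = fun z => levy b α₂ (z - y) := rfl
  simp only [levelSet, mem_ofPred_eq, this, holderExponent_comp_sub,
    holderExponent_levy_eq_iff hb hα₁ h₁, holderExponent_levy_eq_iff hb hα₂ h₂]

lemma tsum_ofReal_rpow_neg_ne_top {b : ℕ} (hb : 2 ≤ b) {β : ℝ} (hβ : 0 < β) (C : ℝ) :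
    ∑' n : ℕ, ENNReal.ofReal (C * (b : ℝ) ^ (-(β * (n : ℝ)))) ≠ ⊤ :=
  ((summable_rpow_neg hb hβ).mul_left C).tsum_ofReal_ne_top

lemma hausdorffMeasure_approximable_inter {b : ℕ} (hb : 2 ≤ b) {a d : ℝ} (ha : 1 ≤ a)
    (hd : 1 / a < d) (m : ℤ) :
    μH[d] ({x | Approximable b a x} ∩ Icc (m : ℝ) (m + 1)) = 0 := by
  have hb0 : (0 : ℝ) < b := by positivity
  have hb1 : (1 : ℝ) ≤ b := by exact_mod_cast (by omega : 1 ≤ b)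
  have ha0 : 0 < a := by linarith
  have hd0 : 0 < d := (by positivity : 0 < 1 / a).trans hd
  have hβ : 0 < a * d - 1 := by
    rw [div_lt_iff₀ ha0] at hd; linarith
  set ρ : ℕ → ℝ := fun n => (b : ℝ) ^ (-(a * n)) with hρ
  have hρ0 : ∀ n, 0 < ρ n := fun n => by positivity
  set t : ∀ N : ℕ, (Σ n : ℕ, Fin (b ^ (n + N) + 1)) → Set ℝ := fun N p =>
    Metric.closedBall (((m : ℝ) * (b : ℝ) ^ (p.1 + N) + (p.2 : ℕ)) / (b : ℝ) ^ (p.1 + N))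
      (ρ (p.1 + N)) with ht
  have hdiam : ∀ N p, Metric.ediam (t N p) ≤ ENNReal.ofReal (2 * ρ (p.1 + N)) := fun N p => by
    simp only [ht]
    rw [Real.closedBall_eq_Icc, Real.ediam_Icc]
    exact ENNReal.ofReal_le_ofReal (by linarith)
  set F : ℕ → ENNReal := fun n =>
    ENNReal.ofReal ((2 * 2 ^ d) * (b : ℝ) ^ (-((a * d - 1) * (n : ℝ)))) with hF
  have hsum : ∀ N, ∑' p, Metric.ediam (t N p) ^ d ≤ ∑' n, F (n + N) := fun N => by
    rw [ENNReal.tsum_sigma']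
    refine ENNReal.tsum_le_tsum fun n => ?_
    calc ∑' j : Fin (b ^ (n + N) + 1), Metric.ediam (t N ⟨n, j⟩) ^ d
        ≤ ∑' _ : Fin (b ^ (n + N) + 1), ENNReal.ofReal ((2 * ρ (n + N)) ^ d) := by
          refine ENNReal.tsum_le_tsum fun j => ?_
          rw [← ENNReal.ofReal_rpow_of_nonneg (by have := hρ0 (n + N); linarith) hd0.le]
          exact ENNReal.rpow_le_rpow (hdiam N ⟨n, j⟩) hd0.le
      _ = ENNReal.ofReal (((b ^ (n + N) + 1 : ℕ) : ℝ) * (2 * ρ (n + N)) ^ d) := by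
          rw [tsum_fintype, Finset.sum_const, Finset.card_univ, Fintype.card_fin, nsmul_eq_mul,
            ENNReal.ofReal_mul (by positivity), ENNReal.ofReal_natCast]
      _ ≤ F (n + N) := by
          refine ENNReal.ofReal_le_ofReal ?_
          have h1 : (1 : ℝ) ≤ (b : ℝ) ^ (n + N) := one_le_pow₀ hb1
          have h2 : (b : ℝ) ^ (-((a * d - 1) * ((n + N : ℕ) : ℝ))) =
              (b : ℝ) ^ (n + N) * ρ (n + N) ^ d := by
            simp only [hρ]
            rw [← Real.rpow_mul hb0.le, ← Real.rpow_natCast, ← Real.rpow_add hb0]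
            congr 1; ring
          rw [h2, Real.mul_rpow (by norm_num) (hρ0 _).le]
          push_cast
          have h3 : 0 ≤ (2 : ℝ) ^ d * ρ (n + N) ^ d := by
            have := hρ0 (n + N); positivity
          nlinarith
  have hcov : ∀ N, {x | Approximable b a x} ∩ Icc (m : ℝ) (m + 1) ⊆ ⋃ p, t N p := by
    rintro N x ⟨hx, hx1, hx2⟩
    rw [mem_ofPred_eq, approximable_iff_frequently hb] at hx
    obtain ⟨n, hn, hnN⟩ := (hx.and_eventually (eventually_ge_atTop N)).exists
    obtain ⟨n, rfl⟩ := Nat.exists_eq_add_of_le' hnN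
    have hbn : (0 : ℝ) < (b : ℝ) ^ (n + N) := by positivity
    have hr := abs_sub_round ((b : ℝ) ^ (n + N) * x)
    rw [abs_le] at hr
    set k := round ((b : ℝ) ^ (n + N) * x) with hk
    have hk1 : m * (b : ℤ) ^ (n + N) ≤ k := by
      have : ((m * (b : ℤ) ^ (n + N) : ℤ) : ℝ) < (k + 1 : ℤ) := by
        push_cast
        nlinarith
      have := Int.cast_lt.1 this
      omega
    have hk2 : k ≤ m * (b : ℤ) ^ (n + N) + (b : ℤ) ^ (n + N) := by
      have : (k : ℝ) < ((m * (b : ℤ) ^ (n + N) + (b : ℤ) ^ (n + N) + 1 : ℤ) : ℝ) := by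
        push_cast
        nlinarith
      have := Int.cast_lt.1 this
      omega
    obtain ⟨j, hj⟩ := Int.eq_ofNat_of_zero_le (sub_nonneg.2 hk1)
    have hjlt : j < b ^ (n + N) + 1 := by
      have : (j : ℤ) < (b ^ (n + N) + 1 : ℕ) := by push_cast; omega
      exact_mod_cast this
    refine mem_iUnion.2 ⟨⟨n, ⟨j, hjlt⟩⟩, ?_⟩
    have hkj : (m : ℝ) * (b : ℝ) ^ (n + N) + j = k := by
      have : m * (b : ℤ) ^ (n + N) + j = k := by omega
      exact_mod_cast this
    simp only [ht, Metric.mem_closedBall, Real.dist_eq, hkj]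
    have e : (b : ℝ) ^ (n + N) * |x - k / (b : ℝ) ^ (n + N)| =
        distInt ((b : ℝ) ^ (n + N) * x) := by
      rw [distInt, ← hk]
      nth_rw 1 [← abs_of_pos hbn]
      rw [← abs_mul]
      congr 1; field_simp
    rw [← e, mul_comm ((n + N : ℕ) : ℝ)] at hn
    exact le_of_mul_le_mul_left hn hbn
  have hr : Tendsto (fun N : ℕ => ENNReal.ofReal (2 * ρ N)) atTop (𝓝 0) := by
    have := ENNReal.tendsto_ofReal ((tendsto_rpow_neg_mul hb ha0).const_mul 2)
    simpa using this
  have hmono : ∀ n N : ℕ, ρ (n + N) ≤ ρ N := fun n N => by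
    simp only [hρ]
    gcongr
    omega
  have key := Measure.hausdorffMeasure_le_liminf_tsum d
    ({x | Approximable b a x} ∩ Icc (m : ℝ) (m + 1)) _ hr t
    (Eventually.of_forall fun N p => (hdiam N p).trans
      (ENNReal.ofReal_le_ofReal (by have := hmono p.1 N; linarith)))
    (Eventually.of_forall hcov)
  have hlim := ENNReal.tendsto_sum_nat_add F (tsum_ofReal_rpow_neg_ne_top hb hβ _)
  refine le_antisymm (key.trans ?_) zero_le
  rw [← hlim.liminf_eq]
  exact liminf_le_liminf (Eventually.of_forall hsum)

lemma dimH_approximable_le {b : ℕ} (hb : 2 ≤ b) {a : ℝ} (ha : 1 ≤ a) :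
    dimH {x | Approximable b a x} ≤ ENNReal.ofReal (1 / a) := by
  have hcov : {x | Approximable b a x} ⊆
      ⋃ m : ℤ, {x | Approximable b a x} ∩ Icc (m : ℝ) (m + 1) := fun x hx =>
    mem_iUnion.2 ⟨⌊x⌋, hx, Int.floor_le x, (Int.lt_floor_add_one x).le⟩
  refine (dimH_mono hcov).trans ?_
  rw [dimH_iUnion]
  refine iSup_le fun m => ?_
  refine le_of_forall_gt_imp_ge_of_dense fun c hc => ?_
  rcases eq_or_ne c ⊤ with rfl | hct
  · exact le_top
  lift c to NNReal using hct
  refine dimH_le_of_hausdorffMeasure_ne_top ?_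
  have hc' : 1 / a < c := by
    rw [← ENNReal.ofReal_coe_nnreal] at hc
    exact (ENNReal.ofReal_lt_ofReal_iff_of_nonneg (by positivity)).1 hc
  rw [hausdorffMeasure_approximable_inter hb ha hc' m]
  exact ENNReal.zero_ne_top

theorem dimH_hasApproxExponent_le {b : ℕ} (hb : 2 ≤ b) {t : ℝ} (ht : t ∈ Icc (0 : ℝ) 1) :
    dimH {x | HasApproxExponent b x t} ≤ ENNReal.ofReal t := by
  rcases ht.2.eq_or_lt with rfl | ht1
  · rw [ENNReal.ofReal_one, ← Real.dimH_univ]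
    exact dimH_mono (subset_univ _)
  refine le_of_forall_gt_imp_ge_of_dense fun c hc => ?_
  rcases eq_or_ne c ⊤ with rfl | hct
  · exact le_top
  lift c to NNReal using hct
  rw [← ENNReal.ofReal_coe_nnreal] at hc
  have hc' : t < c := (ENNReal.ofReal_lt_ofReal_iff_of_nonneg ht.1).1 hc
  obtain ⟨s, h1, h2⟩ := exists_between (lt_min hc' ht1)
  have hs0 : 0 < s := ht.1.trans_lt h1
  have hs : 1 ≤ 1 / s := by rw [le_div_iff₀ hs0]; linarith [h2.trans_le (min_le_right _ _)]
  have hsub : {x | HasApproxExponent b x t} ⊆ {x | Approximable b (1 / s) x} := fun x hx =>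
    (hx _ hs).2 (by rw [mul_one_div, div_lt_one hs0]; exact h1)
  refine (dimH_mono hsub).trans ((dimH_approximable_le hb hs).trans ?_)
  rw [one_div_one_div, ← ENNReal.ofReal_coe_nnreal]
  exact ENNReal.ofReal_le_ofReal (h2.trans_le (min_le_left _ _)).le

/-- The integer with base-`b` digits `ω n, …, ω (n + l - 1)`. -/
def digitBlock {b : ℕ} (ω : ℕ → Fin b) (n : ℕ) : ℕ → ℕ
  | 0 => 0
  | l + 1 => b * digitBlock ω n l + ω (n + l)

lemma digitBlock_lt {b : ℕ} (ω : ℕ → Fin b) (n l : ℕ) : digitBlock ω n l < b ^ l := by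
  induction l with
  | zero => simp [digitBlock]
  | succ l ih =>
    have h := (ω (n + l)).isLt
    rw [digitBlock, pow_succ']
    calc b * digitBlock ω n l + ω (n + l) < b * digitBlock ω n l + b := by omega
      _ = b * (digitBlock ω n l + 1) := by ring
      _ ≤ b * b ^ l := Nat.mul_le_mul_left _ ih

lemma eq_of_digitBlock_eq {b : ℕ} {ω ω' : ℕ → Fin b} {n l : ℕ}
    (h : digitBlock ω n l = digitBlock ω' n l) : ∀ i ∈ Finset.Ico n (n + l), ω i = ω' i := by
  induction l with
  | zero => simp
  | succ l ih =>
    have h1 := (ω (n + l)).isLt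
    have h2 := (ω' (n + l)).isLt
    rw [digitBlock, digitBlock] at h
    have hb : 0 < b := by omega
    have hd : digitBlock ω n l = digitBlock ω' n l := by
      have := congrArg (· / b) h
      simpa [Nat.mul_add_div hb, Nat.div_eq_of_lt h1, Nat.div_eq_of_lt h2] using this
    have hm : (ω (n + l) : ℕ) = ω' (n + l) := by rw [hd] at h; omega
    intro i hi
    rw [Finset.mem_Ico] at hi
    rcases (by omega : i < n + l ∨ i = n + l) with hi' | rfl
    · exact ih hd i (Finset.mem_Ico.2 ⟨hi.1, hi'⟩)
    · exact Fin.ext hm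

lemma digitBlock_congr {b : ℕ} {ω ω' : ℕ → Fin b} {n l : ℕ}
    (h : ∀ i ∈ Finset.Ico n (n + l), ω i = ω' i) : digitBlock ω n l = digitBlock ω' n l := by
  induction l with
  | zero => rfl
  | succ l ih =>
    rw [digitBlock, digitBlock, ih fun i hi => h i ?_, h (n + l) (by simp)]
    rw [Finset.mem_Ico] at hi ⊢; omega

lemma mul_ofDigits {b : ℕ} (hb : 2 ≤ b) (ω : ℕ → Fin b) (n : ℕ) :
    (b : ℝ) * Real.ofDigits (fun i => ω (i + n)) =
      (ω n : ℕ) + Real.ofDigits (fun i => ω (i + (n + 1))) := by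
  have hb0 : (b : ℝ) ≠ 0 := by positivity
  rw [Real.ofDigits_eq_sum_add_ofDigits (fun i => ω (i + n)) 1, Finset.sum_range_one,
    Real.ofDigitsTerm]
  have : (fun i => ω (i + 1 + n)) = fun i => ω (i + (n + 1)) := by
    funext i; congr 1; ring
  rw [this]
  simp only [zero_add, pow_one]
  field_simp

lemma pow_mul_ofDigits {b : ℕ} (hb : 2 ≤ b) (ω : ℕ → Fin b) (n l : ℕ) :
    (b : ℝ) ^ l * Real.ofDigits (fun i => ω (i + n)) =
      digitBlock ω n l + Real.ofDigits (fun i => ω (i + (n + l))) := by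
  induction l with
  | zero => simp [digitBlock]
  | succ l ih =>
    rw [pow_succ', mul_assoc, ih, mul_add, mul_ofDigits hb, digitBlock]
    push_cast
    rw [add_assoc n l 1]; ring

lemma distInt_pow_mul_ofDigits_sub {b : ℕ} (hb : 2 ≤ b) {ω ω' : ℕ → Fin b} {s l : ℕ}
    (h : ∀ i ∈ Finset.Ico s (s + l), ω i = ω' i) :
    distInt ((b : ℝ) ^ s * (Real.ofDigits ω - Real.ofDigits ω')) ≤ 1 / (b : ℝ) ^ l := by
  have hbl : (0 : ℝ) < (b : ℝ) ^ l := by positivity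
  have e1 := pow_mul_ofDigits hb ω 0 s
  have e2 := pow_mul_ofDigits hb ω' 0 s
  have e3 := pow_mul_ofDigits hb ω s l
  have e4 := pow_mul_ofDigits hb ω' s l
  simp only [add_zero, zero_add] at e1 e2
  rw [← digitBlock_congr h] at e4
  refine (distInt_le _ ((digitBlock ω 0 s : ℤ) - (digitBlock ω' 0 s : ℤ))).trans ?_
  rw [mul_sub, e1, e2]
  push_cast
  have e5 : (digitBlock ω 0 s : ℝ) + Real.ofDigits (fun i => ω (i + s)) -
      ((digitBlock ω' 0 s : ℝ) + Real.ofDigits (fun i => ω' (i + s))) -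
      ((digitBlock ω 0 s : ℝ) - digitBlock ω' 0 s) =
      (Real.ofDigits (fun i => ω (i + (s + l))) - Real.ofDigits (fun i => ω' (i + (s + l)))) /
        (b : ℝ) ^ l := by
    rw [eq_div_iff hbl.ne']
    linear_combination e3 - e4
  rw [e5, abs_div, abs_of_pos hbl]
  gcongr
  have h1 := Real.ofDigits_nonneg (fun i => ω (i + (s + l)))
  have h2 := Real.ofDigits_le_one (fun i => ω (i + (s + l)))
  have h3 := Real.ofDigits_nonneg (fun i => ω' (i + (s + l)))
  have h4 := Real.ofDigits_le_one (fun i => ω' (i + (s + l)))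
  rw [abs_le]; constructor <;> linarith

/-- If `bⁿ (z + w)` is within `b^(-l)` of an integer, then the digits of `z` of rank `n` to
`n + l - 1` take at most four values. -/
lemma exists_digitBlock_eq_of_distInt_le {b : ℕ} (hb : 2 ≤ b) (w : ℝ) (n l : ℕ) :
    ∃ W : ℤ, ∀ ω : ℕ → Fin b,
      distInt ((b : ℝ) ^ n * (Real.ofDigits ω + w)) ≤ 1 / (b : ℝ) ^ l →
      ∃ j ∈ Finset.Ico (W - 2) (W + 2), (digitBlock ω n l : ℤ) = j % (b : ℤ) ^ l := by
  have hbl : (0 : ℝ) < (b : ℝ) ^ l := by positivity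
  refine ⟨⌊-((b : ℝ) ^ l * ((b : ℝ) ^ n * w))⌋, fun ω h => ?_⟩
  set β := -((b : ℝ) ^ l * ((b : ℝ) ^ n * w)) with hβ
  have e1 := pow_mul_ofDigits hb ω 0 n
  have e3 := pow_mul_ofDigits hb ω n l
  simp only [add_zero, zero_add] at e1
  set k := round ((b : ℝ) ^ n * (Real.ofDigits ω + w)) with hk
  set θ := Real.ofDigits (fun i => ω (i + (n + l)))
  have hθ0 : 0 ≤ θ := Real.ofDigits_nonneg _
  have hθ1 : θ ≤ 1 := Real.ofDigits_le_one _
  set j : ℤ := digitBlock ω n l + ((digitBlock ω 0 n : ℤ) - k) * (b : ℤ) ^ l with hj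
  have hjβ : |(j : ℝ) + θ - β| ≤ 1 := by
    rw [distInt, ← hk, le_div_iff₀ hbl] at h
    refine le_trans (le_of_eq ?_) h
    rw [← abs_of_pos hbl]
    rw [← abs_mul]
    congr 1
    simp only [hj, hβ]; push_cast
    linear_combination -e3 - (b : ℝ) ^ l * e1
  rw [abs_le] at hjβ
  have h1 := Int.floor_le β
  have h2 := Int.lt_floor_add_one β
  refine ⟨j, Finset.mem_Ico.2 ⟨?_, ?_⟩, ?_⟩
  · have : ((⌊β⌋ - 2 : ℤ) : ℝ) ≤ j := by push_cast; linarith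
    exact_mod_cast this
  · have : (j : ℝ) < ((⌊β⌋ + 2 : ℤ) : ℝ) := by push_cast; linarith
    exact_mod_cast this
  · rw [hj, Int.add_mul_emod_self_right, Int.emod_eq_of_lt (by positivity)]
    exact_mod_cast digitBlock_lt ω n l

/-- The number of elements of `S` in `[n, m)`. -/
def freeCount (S : Set ℕ) (n m : ℕ) : ℕ :=
  open Classical in {i ∈ Finset.Ico n m | i ∈ S}.card

/-- The law of the `i`-th digit: uniform if `i ∈ S`, and equal to `c i` otherwise. -/
def digitLaw {b : ℕ} (S : Set ℕ) (c : ℕ → Fin b) (i : ℕ) : Measure (Fin b) :=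
  open Classical in
  if i ∈ S then ProbabilityTheory.uniformOn univ else Measure.dirac (c i)

instance {b : ℕ} [NeZero b] (S : Set ℕ) (c : ℕ → Fin b) (i : ℕ) :
    IsProbabilityMeasure (digitLaw S c i) := by
  unfold digitLaw
  split_ifs
  · exact ProbabilityTheory.isProbabilityMeasure_uniformOn finite_univ univ_nonempty
  · infer_instance

lemma digitLaw_singleton_of_mem {b : ℕ} [NeZero b] {S : Set ℕ} (c : ℕ → Fin b) {i : ℕ}
    (hi : i ∈ S) (v : Fin b) : digitLaw S c i {v} = (b : ENNReal)⁻¹ := by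
  rw [digitLaw, if_pos hi, ProbabilityTheory.uniformOn_univ]
  simp

/-- The product law on digit sequences. -/
def digitMeasure {b : ℕ} [NeZero b] (S : Set ℕ) (c : ℕ → Fin b) : Measure (ℕ → Fin b) :=
  Measure.infinitePi (digitLaw S c)

instance {b : ℕ} [NeZero b] (S : Set ℕ) (c : ℕ → Fin b) :
    IsProbabilityMeasure (digitMeasure S c) := by
  unfold digitMeasure; infer_instance

lemma digitMeasure_cylinder_le {b : ℕ} [NeZero b] (S : Set ℕ) (c v : ℕ → Fin b) (n m : ℕ) :
    digitMeasure S c {ω | ∀ i ∈ Finset.Ico n m, ω i = v i} ≤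
      (b : ENNReal)⁻¹ ^ freeCount S n m := by
  classical
  have : {ω : ℕ → Fin b | ∀ i ∈ Finset.Ico n m, ω i = v i} =
      Set.pi (Finset.Ico n m : Finset ℕ) fun i => {v i} := by
    ext ω; simp [Set.mem_pi]
  rw [this, digitMeasure, Measure.infinitePi_pi _ fun i _ => measurableSet_singleton _, freeCount,
    Finset.card_filter, ← Finset.prod_pow_eq_pow_sum]
  refine Finset.prod_le_prod' fun i _ => ?_
  split_ifs with hi
  · rw [digitLaw_singleton_of_mem c hi, pow_one]
  · rw [pow_zero]; exact prob_le_one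

lemma ae_digitMeasure_eq {b : ℕ} [NeZero b] (S : Set ℕ) (c : ℕ → Fin b) {i : ℕ} (hi : i ∉ S) :
    ∀ᵐ ω ∂digitMeasure S c, ω i = c i := by
  have h : ∀ᵐ v ∂(digitMeasure S c).map (fun ω => ω i), v = c i := by
    rw [digitMeasure, Measure.infinitePi_map_eval, digitLaw, if_neg hi, ae_dirac_eq]
    rfl
  exact ae_of_ae_map (measurable_pi_apply i).aemeasurable h

/-- The law of the random number whose digits of rank in `S` are uniform and independent, and whose
other digits are those of `c`. -/
theorem exists_cantor_measure {b : ℕ} (hb : 2 ≤ b) (S : Set ℕ) (c : ℕ → Fin b) :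
    ∃ μ : Measure ℝ, IsProbabilityMeasure μ ∧
      (∀ (w : ℝ) (n l : ℕ), μ {z | distInt ((b : ℝ) ^ n * (z + w)) ≤ 1 / (b : ℝ) ^ l} ≤
        4 * (b : ENNReal)⁻¹ ^ freeCount S n (n + l)) ∧
      (∀ (v : ℕ → Fin b) (s l : ℕ), (∀ i ∈ Finset.Ico s (s + l), i ∉ S ∧ c i = v i) →
        ∀ᵐ z ∂μ, distInt ((b : ℝ) ^ s * (z - Real.ofDigits v)) ≤ 1 / (b : ℝ) ^ l) := by
  have : NeZero b := ⟨by omega⟩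
  have hmeas : Measurable (Real.ofDigits : (ℕ → Fin b) → ℝ) := Real.continuous_ofDigits.measurable
  have hset : ∀ (w : ℝ) (n l : ℕ),
      MeasurableSet {z : ℝ | distInt ((b : ℝ) ^ n * (z + w)) ≤ 1 / (b : ℝ) ^ l} := fun w n l =>
    measurableSet_le (measurable_distInt.comp (by fun_prop)) measurable_const
  refine ⟨(digitMeasure S c).map Real.ofDigits, Measure.isProbabilityMeasure_map hmeas.aemeasurable,
    fun w n l => ?_, fun v s l hv => ?_⟩
  · rw [Measure.map_apply hmeas (hset w n l)]
    obtain ⟨W, hW⟩ := exists_digitBlock_eq_of_distInt_le hb w n l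
    have hsub : Real.ofDigits ⁻¹' {z : ℝ | distInt ((b : ℝ) ^ n * (z + w)) ≤ 1 / (b : ℝ) ^ l} ⊆
        ⋃ j ∈ Finset.Ico (W - 2) (W + 2),
          {ω : ℕ → Fin b | (digitBlock ω n l : ℤ) = j % (b : ℤ) ^ l} := fun ω hω => by
      obtain ⟨j, hj, h⟩ := hW ω hω
      exact mem_iUnion₂.2 ⟨j, hj, h⟩
    refine (measure_mono hsub).trans ((measure_biUnion_finset_le _ _).trans ?_)
    refine (Finset.sum_le_card_nsmul _ _ ((b : ENNReal)⁻¹ ^ freeCount S n (n + l))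
      fun j _ => ?_).trans (le_of_eq ?_)
    · rcases eq_empty_or_nonempty {ω : ℕ → Fin b | (digitBlock ω n l : ℤ) = j % (b : ℤ) ^ l} with
        h | ⟨v, hv⟩
      · rw [h, measure_empty]; exact zero_le
      · refine (measure_mono fun ω hω => ?_).trans (digitMeasure_cylinder_le S c v n (n + l))
        exact eq_of_digitBlock_eq (Nat.cast_injective (R := ℤ) (hω.trans hv.symm))
    · rw [Int.card_Ico, nsmul_eq_mul]
      congr 1
      have : (W + 2 - (W - 2)).toNat = 4 := by omega
      rw [this]; norm_num
  · have h1 : ∀ᵐ ω ∂digitMeasure S c, ∀ i ∈ Finset.Ico s (s + l), ω i = v i := by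
      rw [Filter.eventually_all_finset]
      intro i hi
      rw [← (hv i hi).2]
      exact ae_digitMeasure_eq S c (hv i hi).1
    have hm : MeasurableSet {z : ℝ | distInt ((b : ℝ) ^ s * (z - Real.ofDigits v)) ≤
        1 / (b : ℝ) ^ l} := by
      simpa only [sub_eq_add_neg] using hset (-Real.ofDigits v) s l
    rw [ae_map_iff hmeas.aemeasurable hm]
    exact h1.mono fun ω hω => distInt_pow_mul_ofDigits_sub hb hω

lemma exists_sparse_seq {A : ℕ → Set ℕ} (hA : ∀ k, (A k).Infinite) (g : ℕ → ℕ → ℕ) :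
    ∃ s : ℕ → ℕ, ∀ k, s k ∈ A k ∧ g k (s k) ≤ s (k + 1) := by
  have h : ∀ k N, ∃ n, n ∈ A k ∧ N ≤ n := fun k N => by
    obtain ⟨n, hn, hN⟩ := (hA k).exists_gt N
    exact ⟨n, hn, hN.le⟩
  choose f hf hf' using h
  let s : ℕ → ℕ := fun k => Nat.rec (f 0 0) (fun k n => f (k + 1) (g k n)) k
  refine ⟨s, fun k => ⟨?_, hf' (k + 1) (g k (s k))⟩⟩
  cases k with
  | zero => exact hf 0 0
  | succ k => exact hf (k + 1) (g k (s k))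

/-- The complement of the union of the blocks `[s k, e k)`. -/
def blockFree (s e : ℕ → ℕ) : Set ℕ := {i | ∀ k, ¬ (s k ≤ i ∧ i < e k)}

/-- For sparse blocks, a window `[n, m)` with `m ≤ M n` and `n` large meets at most one of them. -/
lemma exists_unique_block {s e : ℕ → ℕ} (hs : StrictMono s) (hle : ∀ k, s k ≤ e k)
    (hse : ∀ k, (k + 1) * e k ≤ s (k + 1)) (M K : ℕ) :
    ∃ n₀, ∀ n ≥ n₀, ∀ m ≤ M * n, ∃ k ≥ K, ∀ i ∈ Finset.Ico n m, i ∉ blockFree s e →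
      s k ≤ i ∧ i < e k := by
  refine ⟨s (max K M + 1), fun n hn m hm => ?_⟩
  by_cases hnm : m ≤ n
  · exact ⟨K, le_rfl, fun i hi => by rw [Finset.mem_Ico] at hi; omega⟩
  set k := Nat.findGreatest (fun k => s k ≤ m) m with hk
  have hKm : s (max K M + 1) ≤ m := by omega
  have hKk : max K M + 1 ≤ k := Nat.le_findGreatest (hs.le_apply.trans hKm) hKm
  have hkm : s k ≤ m := Nat.findGreatest_spec (P := fun k => s k ≤ m) (hs.le_apply.trans hKm) hKm
  refine ⟨k, by omega, fun i hi hiS => ?_⟩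
  rw [Finset.mem_Ico] at hi
  simp only [blockFree, mem_ofPred_eq, not_forall, not_not] at hiS
  obtain ⟨j, hj1, hj2⟩ := hiS
  have hjm : s j ≤ m := by omega
  have hjk : j ≤ k := Nat.le_findGreatest (hs.le_apply.trans hjm) hjm
  rcases hjk.eq_or_lt with rfl | hlt
  · exact ⟨hj1, hj2⟩
  · exfalso
    have hjs : (j + 1) * e j ≤ s k := (hse j).trans (hs.monotone hlt)
    have hek : k * e j ≤ s k := by
      rcases (by omega : j + 1 = k ∨ j + 1 < k) with h | h
      · rw [← h]; rw [← h] at hjs; exact hjs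
      · obtain ⟨k', hk'⟩ : ∃ k', k = k' + 1 := ⟨k - 1, by omega⟩
        rw [hk']
        refine le_trans (Nat.mul_le_mul_left _ ?_) (hse k')
        by_contra! hlt'
        have h1 : s (j + 1) ≤ s k' := hs.monotone (by omega)
        have h2 : e j ≤ (j + 1) * e j := Nat.le_mul_of_pos_left _ (by omega)
        have h3 := hse j
        have h4 := hle k'
        omega
    have h1 : M * (i + 1) ≤ M * e j := Nat.mul_le_mul_left _ hj2
    have h2 : (M + 1) * e j ≤ k * e j := Nat.mul_le_mul_right _ (by omega)
    have h3 : M * n ≤ M * i := Nat.mul_le_mul_left _ hi.1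
    have h4 : 0 < e j := by omega
    nlinarith

lemma le_freeCount_add {S : Set ℕ} {n m s e : ℕ}
    (h : ∀ i ∈ Finset.Ico n m, i ∉ S → s ≤ i ∧ i < e) :
    m - n ≤ freeCount S n m + (min m e - max n s) := by
  classical
  have hsub : Finset.Ico n m ⊆ {i ∈ Finset.Ico n m | i ∈ S} ∪ Finset.Ico (max n s) (min m e) := by
    intro i hi
    by_cases hiS : i ∈ S
    · exact Finset.mem_union_left _ (Finset.mem_filter.2 ⟨hi, hiS⟩)
    · have := h i hi hiS
      rw [Finset.mem_Ico] at hi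
      exact Finset.mem_union_right _ (Finset.mem_Ico.2 ⟨by omega, by omega⟩)
  have := (Finset.card_le_card hsub).trans (Finset.card_union_le _ _)
  rw [Nat.card_Ico, Nat.card_Ico] at this
  unfold freeCount
  convert this

lemma freeCount_cases {S : Set ℕ} {n m s e : ℕ}
    (h : ∀ i ∈ Finset.Ico n m, i ∉ S → s ≤ i ∧ i < e) :
    m ≤ n + freeCount S n m ∨ (s ≤ n ∧ m ≤ freeCount S n m + e) ∨
      (n < s ∧ m + s ≤ n + freeCount S n m + e ∧ s ≤ n + freeCount S n m) := by
  have := le_freeCount_add h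
  omega

lemma freeCount_mono {S : Set ℕ} {n n' m : ℕ} (h : n ≤ n') : freeCount S n' m ≤ freeCount S n m := by
  classical
  unfold freeCount
  refine Finset.card_le_card (Finset.filter_subset_filter _ ?_)
  exact Finset.Ico_subset_Ico_left h

lemma freeCount_ge_of_ratio_le {S : Set ℕ} {n m s e : ℕ} {δ ε : ℝ} (hδ : 1 ≤ δ) (hε : 0 ≤ ε)
    (h : ∀ i ∈ Finset.Ico n m, i ∉ S → s ≤ i ∧ i < e) (he : (e : ℝ) ≤ δ * s + 1)
    (hm : n * (δ + ε) - 1 ≤ m) :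
    ε / δ * n - 2 ≤ freeCount S n m := by
  set c := freeCount S n m
  have hδ0 : 0 < δ := by linarith
  have hn0 : (0 : ℝ) ≤ n := by positivity
  have hc0 : (0 : ℝ) ≤ c := by positivity
  have hdiv : ε / δ * n ≤ ε * n := by
    gcongr; exact div_le_self hε hδ
  have hεn : 0 ≤ ε * n := by positivity
  rcases freeCount_cases h with h1 | ⟨h1, h2⟩ | ⟨h1, h2, h3⟩
  · have h1' : (m : ℝ) ≤ n + c := by exact_mod_cast h1
    nlinarith
  · have h1' : (s : ℝ) ≤ n := by exact_mod_cast h1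
    have h2' : (m : ℝ) ≤ c + e := by exact_mod_cast h2
    nlinarith
  · have h2' : (m : ℝ) + s ≤ n + c + e := by exact_mod_cast h2
    have h3' : (s : ℝ) ≤ n + c := by exact_mod_cast h3
    have h4 : (m : ℝ) ≤ δ * (n + c) + 1 := by nlinarith
    have h5 : ε * n ≤ δ * (c + 2) := by nlinarith
    have h6 : ε / δ * n ≤ c + 2 := by
      rw [div_mul_eq_mul_div, div_le_iff₀ hδ0]; linarith
    linarith

/-- **Mass distribution principle** along `b`-adic scales. -/
theorem le_dimH_of_measure_closedBall_le {b : ℕ} (hb : 2 ≤ b) {μ : Measure ℝ}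
    [IsProbabilityMeasure μ] {E : Set ℝ} (hE : ∀ᵐ z ∂μ, z ∈ E) {t : ℝ}
    (h : ∀ r, 0 < r → r < t → ∃ C > 0, ∀ᶠ N : ℕ in atTop, ∀ x,
      μ (Metric.closedBall x (1 / (b : ℝ) ^ N)) ≤ ENNReal.ofReal (C * (b : ℝ) ^ (-(r * N)))) :
    ENNReal.ofReal t ≤ dimH E := by
  have hb0 : (0 : ℝ) < b := by positivity
  have hb1 : (1 : ℝ) < b := by exact_mod_cast hb
  refine le_of_forall_lt_imp_le_of_dense fun c hc => ?_
  lift c to NNReal using (hc.trans ENNReal.ofReal_lt_top).ne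
  rcases eq_or_ne c 0 with rfl | hc0
  · simp
  have hcpos : (0 : ℝ) < c := by exact_mod_cast pos_iff_ne_zero.2 hc0
  have hct : (c : ℝ) < t := by
    rw [← ENNReal.ofReal_coe_nnreal] at hc
    exact (ENNReal.ofReal_lt_ofReal_iff_of_nonneg hcpos.le).1 hc
  obtain ⟨r, hcr, hrt⟩ := exists_between hct
  have hr0 : 0 < r := hcpos.trans hcr
  obtain ⟨C, hC, hN⟩ := h r hr0 hrt
  have hlim : Tendsto (fun N : ℕ => C * (b : ℝ) ^ r * (b : ℝ) ^ (-((r - c) * N))) atTop (𝓝 0) := by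
    simpa using (tendsto_rpow_neg_mul hb (sub_pos.2 hcr)).const_mul (C * (b : ℝ) ^ r)
  obtain ⟨N₁, hN₁⟩ := eventually_atTop.1 (hN.and (hlim.eventually (gt_mem_nhds one_pos)))
  have hle : μ ≤ Measure.hausdorffMeasure (c : ℝ) := by
    refine Measure.le_hausdorffMeasure (c : ℝ) μ (ENNReal.ofReal (1 / (b : ℝ) ^ N₁))
      (ENNReal.ofReal_pos.2 (by positivity)) fun A hA => ?_
    rcases A.eq_empty_or_nonempty with rfl | ⟨x, hx⟩
    · simp
    have hfin : Metric.ediam A ≠ ⊤ := (hA.trans_lt ENNReal.ofReal_lt_top).ne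
    set ρ := (Metric.ediam A).toReal with hρ
    have hρeq : Metric.ediam A = ENNReal.ofReal ρ := (ENNReal.ofReal_toReal hfin).symm
    have hρ0 : 0 ≤ ρ := ENNReal.toReal_nonneg
    have hρ1 : ρ ≤ 1 / (b : ℝ) ^ N₁ := by
      rw [hρeq] at hA
      exact (ENNReal.ofReal_le_ofReal_iff (by positivity)).1 hA
    have hsub : ∀ N : ℕ, ρ ≤ 1 / (b : ℝ) ^ N → A ⊆ Metric.closedBall x (1 / (b : ℝ) ^ N) := by
      intro N hρN z hz
      rw [Metric.mem_closedBall]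
      refine le_trans ?_ hρN
      rw [dist_edist]
      exact ENNReal.toReal_mono hfin (Metric.edist_le_ediam_of_mem hz hx)
    rcases hρ0.eq_or_lt with h0 | hpos
    · have hz : μ A ≤ 0 := by
        have hl : Tendsto (fun N : ℕ => ENNReal.ofReal (C * (b : ℝ) ^ (-(r * N)))) atTop (𝓝 0) := by
          have := ENNReal.tendsto_ofReal ((tendsto_rpow_neg_mul hb hr0).const_mul C)
          simpa using this
        refine ge_of_tendsto hl ?_
        filter_upwards [hN] with N hNx
        exact (measure_mono (hsub N (by rw [← h0]; positivity))).trans (hNx x)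
      exact hz.trans zero_le
    · have hρlt : ρ ≤ 1 := hρ1.trans (by
        rw [div_le_one (by positivity)]; exact one_le_pow₀ hb1.le)
      obtain ⟨N, hN1, hN2⟩ := exists_nat_pow_near_of_lt_one hpos hρlt
        (show (0 : ℝ) < 1 / b by positivity) (by rw [div_lt_one hb0]; exact hb1)
      rw [one_div_pow] at hN1 hN2
      have hNN : N₁ ≤ N := by
        by_contra! hlt
        have h1 : (b : ℝ) ^ (N + 1) ≤ (b : ℝ) ^ N₁ := pow_le_pow_right₀ hb1.le hlt
        have h2 := one_div_le_one_div_of_le (by positivity) h1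
        linarith
      obtain ⟨h1, h2⟩ := hN₁ N hNN
      refine (measure_mono (hsub N hN2)).trans ((h1 x).trans ?_)
      rw [hρeq, ENNReal.ofReal_rpow_of_nonneg hρ0 hcpos.le]
      refine ENNReal.ofReal_le_ofReal ?_
      have h3 : (b : ℝ) ^ (-(c * (N + 1 : ℝ))) ≤ ρ ^ (c : ℝ) := by
        have : (b : ℝ) ^ (-(c * (N + 1 : ℝ))) = (1 / (b : ℝ) ^ (N + 1)) ^ (c : ℝ) := by
          rw [one_div, ← Real.rpow_natCast, ← Real.rpow_neg hb0.le, ← Real.rpow_mul hb0.le]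
          congr 1; push_cast; ring
        rw [this]
        exact Real.rpow_le_rpow (by positivity) hN1.le hcpos.le
      refine le_trans ?_ h3
      have h4 : C * (b : ℝ) ^ (-(r * N)) = (C * (b : ℝ) ^ (c : ℝ) * (b : ℝ) ^ (-((r - c) * N))) *
          (b : ℝ) ^ (-(c * (N + 1 : ℝ))) := by
        have : (b : ℝ) ^ (-(r * N)) = (b : ℝ) ^ (c : ℝ) * (b : ℝ) ^ (-((r - c) * N)) *
          (b : ℝ) ^ (-(c * (N + 1 : ℝ))) := by
          rw [← Real.rpow_add hb0, ← Real.rpow_add hb0]; congr 1; ring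
        rw [this]; ring
      rw [h4]
      refine mul_le_of_le_one_left (by positivity) (le_trans ?_ h2.le)
      gcongr
      exact hb1.le
  refine le_dimH_of_hausdorffMeasure_ne_zero ?_
  have h1 : 1 ≤ μ E := by
    have h2 : μ Eᶜ = 0 := hE
    have h3 := measure_union_le (μ := μ) E Eᶜ
    rwa [union_compl_self, measure_univ, h2, add_zero] at h3
  exact (one_pos.trans_le (h1.trans (hle E))).ne'

lemma distInt_pow_mul_le_of_le {b n m : ℕ} (hb : 2 ≤ b) (hnm : n ≤ m) {x q : ℝ}
    (h : distInt ((b : ℝ) ^ n * x) ≤ (b : ℝ) ^ n * q) :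
    distInt ((b : ℝ) ^ m * x) ≤ (b : ℝ) ^ m * q := by
  have hb0 : (0 : ℝ) < b := by positivity
  have h1 := distInt_pow_mul_le b (m - n) ((b : ℝ) ^ n * x)
  have h2 : (b : ℝ) ^ m = (b : ℝ) ^ (m - n) * (b : ℝ) ^ n := by
    rw [← pow_add, Nat.sub_add_cancel hnm]
  rw [h2, mul_assoc, mul_assoc]
  exact h1.trans (mul_le_mul_of_nonneg_left h (by positivity))

lemma one_div_pow_sub_le {b s e : ℕ} (hb : 2 ≤ b) (hse : s ≤ e) {d : ℝ} (hd : s * d ≤ e) :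
    1 / (b : ℝ) ^ (e - s) ≤ (b : ℝ) ^ s * (b : ℝ) ^ (-(s * d)) := by
  have hb0 : (0 : ℝ) < b := by positivity
  have hb1 : (1 : ℝ) ≤ b := by exact_mod_cast (by omega : 1 ≤ b)
  rw [one_div, ← Real.rpow_natCast, ← Real.rpow_natCast, ← Real.rpow_neg hb0.le,
    ← Real.rpow_add hb0, Nat.cast_sub hse]
  exact Real.rpow_le_rpow_of_exponent_le hb1 (by linarith)

lemma hasApproxExponent_inv {b : ℕ} (hb : 2 ≤ b) {δ x : ℝ} (hδ : 0 < δ)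
    (h1 : Approximable b δ x) (h2 : ∀ j : ℕ, ¬ Approximable b (δ + 1 / (j + 1 : ℝ)) x) :
    HasApproxExponent b x (1 / δ) := by
  intro a ha
  rw [one_div_mul_eq_div, div_le_one hδ, div_lt_one hδ]
  refine ⟨fun happ => ?_, fun hlt => h1.mono hb hlt.le⟩
  by_contra! hlt
  obtain ⟨j, hj⟩ := exists_nat_one_div_lt (sub_pos.2 hlt)
  exact h2 j (happ.mono hb (by linarith))

lemma HasApproxExponent.not_approximable {b : ℕ} {δ x a : ℝ} (hδ : 1 ≤ δ)
    (h : HasApproxExponent b x (1 / δ)) (ha : δ < a) : ¬ Approximable b a x := fun happ => by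
  have := (h a (by linarith)).1 happ
  rw [one_div_mul_eq_div, div_le_one (by linarith)] at this
  linarith

lemma HasApproxExponent.approximable {b : ℕ} (hb : 2 ≤ b) {δ x a : ℝ}
    (h : HasApproxExponent b x (1 / δ)) (ha : a < δ) : Approximable b a x := by
  rcases le_total a 1 with h1 | h1
  · exact (approximable_one b x).mono hb h1
  · exact (h a h1).2 (by rwa [one_div_mul_eq_div, div_lt_one (by linarith)])

lemma four_mul_inv_pow_le {b : ℕ} (hb : 2 ≤ b) {t C : ℝ} {k : ℕ} (h : t - C ≤ k) :
    4 * (b : ENNReal)⁻¹ ^ k ≤ ENNReal.ofReal (4 * (b : ℝ) ^ C * (b : ℝ) ^ (-t)) := by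
  have hb0 : (0 : ℝ) < b := by positivity
  have hb1 : (1 : ℝ) ≤ b := by exact_mod_cast (by omega : 1 ≤ b)
  have e1 : 4 * (b : ENNReal)⁻¹ ^ k = ENNReal.ofReal (4 * (b : ℝ) ^ (-(k : ℝ))) := by
    rw [ENNReal.ofReal_mul (by norm_num), Real.rpow_neg hb0.le, Real.rpow_natCast, ← inv_pow,
      ENNReal.ofReal_pow (by positivity), ENNReal.ofReal_inv_of_pos hb0]
    simp
  rw [e1]
  refine ENNReal.ofReal_le_ofReal ?_
  rw [mul_assoc, ← Real.rpow_add hb0]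
  have := Real.rpow_le_rpow_of_exponent_le hb1 (show -(k : ℝ) ≤ C + -t by linarith)
  linarith

lemma tsum_inv_pow_ne_top {b : ℕ} (hb : 2 ≤ b) {κ C : ℝ} (hκ : 0 < κ) {f : ℕ → ℕ} :
    ∑' n : ℕ, (if κ * n - C ≤ f n then 4 * (b : ENNReal)⁻¹ ^ f n else 0) ≠ ⊤ := by
  refine ne_top_of_le_ne_top (tsum_ofReal_rpow_neg_ne_top hb hκ (4 * (b : ℝ) ^ C))
    (ENNReal.tsum_le_tsum fun n => ?_)
  split_ifs with h
  · exact four_mul_inv_pow_le hb h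
  · exact zero_le

/-- Borel–Cantelli: if the windows `[n, n a)` contain a positive proportion of free digits, unless
`n` is excluded for another reason, then almost surely `z + w` is not `a`-approximable. -/
lemma ae_not_approximable {b : ℕ} (hb : 2 ≤ b) {μ : Measure ℝ} {S : Set ℕ}
    (hμ : ∀ (w : ℝ) (n l : ℕ), μ {z | distInt ((b : ℝ) ^ n * (z + w)) ≤ 1 / (b : ℝ) ^ l} ≤
      4 * (b : ENNReal)⁻¹ ^ freeCount S n (n + l)) {a w κ C : ℝ} (ha : 1 ≤ a) (hκ : 0 < κ)
    (h : ∀ᶠ n : ℕ in atTop, κ * n - C ≤ freeCount S n (n + ⌊n * (a - 1)⌋₊) ∨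
      ∀ᵐ z ∂μ, ¬ distInt ((b : ℝ) ^ n * (z + w)) ≤ (b : ℝ) ^ n * (b : ℝ) ^ (-(n * a))) :
    ∀ᵐ z ∂μ, ¬ Approximable b a (z + w) := by
  have hb0 : (0 : ℝ) < b := by positivity
  have hb1 : (1 : ℝ) ≤ b := by exact_mod_cast (by omega : 1 ≤ b)
  obtain ⟨n₀, hn₀⟩ := eventually_atTop.1 h
  set f : ℕ → ℕ := fun n => freeCount S n (n + ⌊n * (a - 1)⌋₊) with hf
  set B : ℕ → Set ℝ := fun n =>
    {z | n₀ ≤ n ∧ distInt ((b : ℝ) ^ n * (z + w)) ≤ (b : ℝ) ^ n * (b : ℝ) ^ (-(n * a))} with hB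
  have hBle : ∀ n, μ (B n) ≤ if κ * n - C ≤ f n then 4 * (b : ENNReal)⁻¹ ^ f n else 0 := fun n => by
    by_cases hn : n₀ ≤ n
    · split_ifs with hκn
      · refine (measure_mono fun z hz => ?_).trans (hμ w n ⌊n * (a - 1)⌋₊)
        refine hz.2.trans ?_
        rw [← approx_bound_eq hb]
        refine one_div_le_one_div_of_le (by positivity) ?_
        rw [← Real.rpow_natCast]
        refine Real.rpow_le_rpow_of_exponent_le hb1 (Nat.floor_le ?_)
        have : (0 : ℝ) ≤ n := by positivity
        nlinarith
      · have h0 := (hn₀ n hn).resolve_left hκn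
        refine le_of_eq (measure_mono_null (fun z hz => ?_) (ae_iff.1 h0))
        exact not_not.2 hz.2
    · have : B n = ∅ := by
        ext z; simp [hB, hn]
      rw [this, measure_empty]; exact zero_le
  have hsum : ∑' n, μ (B n) ≠ ⊤ :=
    ne_top_of_le_ne_top (tsum_inv_pow_ne_top hb hκ (f := f)) (ENNReal.tsum_le_tsum hBle)
  filter_upwards [ae_eventually_notMem hsum] with z hz happ
  rw [approximable_iff_frequently hb] at happ
  obtain ⟨n, hn, hn1, hn2⟩ := (happ.and_eventually (hz.and (eventually_ge_atTop n₀))).exists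
  exact hn1 ⟨hn2, hn⟩

/-- Transfer of a bad approximation of `x₀` to `z + y`, when `z` and `x₀ - y` have a common good
approximation of rank `s`. -/
lemma block_end_lt_of_distInt_le {b n s : ℕ} (hb : 2 ≤ b) {x₀ y z d₁ d₂ ε η : ℝ} (hη : 0 ≤ η)
    (hε : 1 ≤ n * (ε / 2))
    (hev : distInt ((b : ℝ) ^ n * (z + y)) ≤ (b : ℝ) ^ n * (b : ℝ) ^ (-(n * (d₁ + ε))))
    (hz : distInt ((b : ℝ) ^ s * z) ≤ (b : ℝ) ^ s * (b : ℝ) ^ (-(s * d₂)))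
    (hz₀ : distInt ((b : ℝ) ^ s * (x₀ - y)) ≤ (b : ℝ) ^ s * (b : ℝ) ^ (-(s * (d₂ - η))))
    (hx₀ : (b : ℝ) ^ max n s * (b : ℝ) ^ (-((max n s : ℕ) * (d₁ + ε / 4))) <
      distInt ((b : ℝ) ^ max n s * x₀))
    (hmax : (max n s : ℕ) * (d₁ + ε / 4) ≤ n * (d₁ + ε / 2)) :
    s * (d₂ - η) < n * (d₁ + ε / 2) + 2 := by
  have hb0 : (0 : ℝ) < b := by positivity
  have hb1 : (1 : ℝ) ≤ b := by exact_mod_cast (by omega : 1 ≤ b)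
  have hb2 : (2 : ℝ) ≤ b := by exact_mod_cast hb
  by_contra! hle
  have e1 := distInt_pow_mul_le_of_le hb (le_max_left n s) hev
  have e2 := distInt_pow_mul_le_of_le hb (le_max_right n s) hz
  have e3 := distInt_pow_mul_le_of_le hb (le_max_right n s) hz₀
  set m := max n s
  set X : ℝ := (b : ℝ) ^ (-(n * (d₁ + ε / 2))) with hX
  have hX0 : 0 < X := by positivity
  have hbm : (0 : ℝ) < (b : ℝ) ^ m := by positivity
  have i0 : X ≤ (b : ℝ) ^ (-((m : ℕ) * (d₁ + ε / 4))) :=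
    Real.rpow_le_rpow_of_exponent_le hb1 (by linarith)
  have hhalf : (b : ℝ) ^ (-1 : ℝ) ≤ 1 / 2 := by
    rw [Real.rpow_neg_one, ← one_div]
    exact one_div_le_one_div_of_le two_pos hb2
  have i1 : (b : ℝ) ^ (-(n * (d₁ + ε))) ≤ X * (1 / 2) := by
    refine le_trans ?_ (mul_le_mul_of_nonneg_left hhalf hX0.le)
    rw [hX, ← Real.rpow_add hb0]
    exact Real.rpow_le_rpow_of_exponent_le hb1 (by linarith)
  have i3 : (b : ℝ) ^ (-(s * (d₂ - η))) ≤ X * (1 / 2) * (1 / 2) := by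
    calc (b : ℝ) ^ (-(s * (d₂ - η))) ≤ X * (b : ℝ) ^ (-1 : ℝ) * (b : ℝ) ^ (-1 : ℝ) := by
          rw [hX, ← Real.rpow_add hb0, ← Real.rpow_add hb0]
          exact Real.rpow_le_rpow_of_exponent_le hb1 (by linarith)
      _ ≤ X * (1 / 2) * (1 / 2) := by gcongr
  have i2 : (b : ℝ) ^ (-(s * d₂)) ≤ (b : ℝ) ^ (-(s * (d₂ - η))) := by
    refine Real.rpow_le_rpow_of_exponent_le hb1 ?_
    have : (0 : ℝ) ≤ s * η := by positivity
    linarith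
  have hdec : (b : ℝ) ^ m * x₀ = (b : ℝ) ^ m * (z + y) - (b : ℝ) ^ m * z +
      (b : ℝ) ^ m * (x₀ - y) := by ring
  have j1 := distInt_add_le ((b : ℝ) ^ m * (z + y) - (b : ℝ) ^ m * z) ((b : ℝ) ^ m * (x₀ - y))
  have j2 := distInt_sub_le ((b : ℝ) ^ m * (z + y)) ((b : ℝ) ^ m * z)
  rw [← hdec] at j1
  have : (b : ℝ) ^ m * (b : ℝ) ^ (-((m : ℕ) * (d₁ + ε / 4))) < (b : ℝ) ^ m *
      ((b : ℝ) ^ (-(n * (d₁ + ε))) + (b : ℝ) ^ (-(s * d₂)) + (b : ℝ) ^ (-(s * (d₂ - η)))) := by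
    refine hx₀.trans_le ?_
    rw [mul_add, mul_add]; linarith
  have := lt_of_mul_lt_mul_left this hbm.le
  linarith

lemma freeCount_ge_of_block_end_lt {S : Set ℕ} {n m s e : ℕ} {d₁ d₂ ε η κ : ℝ} (hd₁ : 1 ≤ d₁)
    (hε : 0 < ε) (hη : η ≤ ε / 8) (hη0 : 0 ≤ η) (hκ1 : κ ≤ 1) (hκε : κ ≤ ε / 4)
    (h : ∀ i ∈ Finset.Ico n m, i ∉ S → s ≤ i ∧ i < e) (he : (e : ℝ) ≤ d₂ * s + 1)
    (hm : n * (d₁ + ε) - 1 ≤ m)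
    (hs : n * (1 + κ) < s ∨ s * (d₂ - η) < n * (d₁ + ε / 2) + 2) :
    κ * n - 4 ≤ freeCount S n m := by
  set c := freeCount S n m
  have hn0 : (0 : ℝ) ≤ n := by positivity
  have hc0 : (0 : ℝ) ≤ c := by positivity
  have hκn : κ * n ≤ ε / 4 * n := by gcongr
  have hεn : 0 ≤ ε * n := by positivity
  have hend : (m : ℝ) ≤ c + e → (s : ℝ) ≤ n * (1 + κ) →
      s * (d₂ - η) < n * (d₁ + ε / 2) + 2 → κ * n - 4 ≤ c := fun h1 h2 h3 => by
    have h4 : (s : ℝ) ≤ 2 * n := by nlinarith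
    have h5 : s * η ≤ 2 * n * (ε / 8) := by gcongr
    nlinarith
  rcases freeCount_cases h with h1 | ⟨h1, h2⟩ | ⟨h1, h2, h3⟩
  · have h1' : (m : ℝ) ≤ n + c := by exact_mod_cast h1
    nlinarith
  · have h1' : (s : ℝ) ≤ n := by exact_mod_cast h1
    have h2' : (m : ℝ) ≤ c + e := by exact_mod_cast h2
    by_cases hκn' : κ * n ≤ 0
    · linarith
    · rcases hs with hs | hs
      · linarith
      · exact hend h2' (by linarith) hs
  · have h1' : (n : ℝ) < s := by exact_mod_cast h1
    have h2' : (m : ℝ) + s ≤ n + c + e := by exact_mod_cast h2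
    have h3' : (s : ℝ) ≤ n + c := by exact_mod_cast h3
    by_cases hns : (n : ℝ) * (1 + κ) < s
    · linarith
    · exact hend (by linarith) (not_lt.1 hns) (hs.resolve_left hns)

lemma block_index_unique {s e : ℕ → ℕ} (hs : StrictMono s) (hes : ∀ k, e k ≤ s (k + 1)) {i j k : ℕ}
    (hj : s j ≤ i ∧ i < e j) (hk : s k ≤ i ∧ i < e k) : j = k := by
  have key : ∀ {j k : ℕ}, s k ≤ i → i < e j → ¬ j < k := fun {j k} h1 h2 hlt => by
    have h3 := hes j
    have h4 := hs.monotone (Nat.succ_le_of_lt hlt)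
    rw [Nat.succ_eq_add_one] at h4
    omega
  have h1 := key hk.1 hj.2
  have h2 := key hj.1 hk.2
  omega

lemma exists_block_of_window {s e : ℕ → ℕ} (hs : StrictMono s) (hle : ∀ k, s k ≤ e k)
    (hse : ∀ k, (k + 1) * e k ≤ s (k + 1)) {a : ℝ} (ha : 1 ≤ a) (K : ℕ) :
    ∀ᶠ n : ℕ in atTop, n * a - 1 ≤ (n + ⌊n * (a - 1)⌋₊ : ℕ) ∧
      ∃ k ≥ K, ∀ i ∈ Finset.Ico n (n + ⌊n * (a - 1)⌋₊), i ∉ blockFree s e →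
        s k ≤ i ∧ i < e k := by
  obtain ⟨n₀, hn₀⟩ := exists_unique_block hs hle hse ⌈a⌉₊ K
  filter_upwards [eventually_ge_atTop n₀] with n hn
  have hn0 : (0 : ℝ) ≤ n := by positivity
  have h0 : 0 ≤ n * (a - 1) := mul_nonneg hn0 (by linarith)
  have h1 := Nat.floor_le h0
  have h2 := Nat.lt_floor_add_one (n * (a - 1))
  refine ⟨by push_cast; linarith, hn₀ n hn _ ?_⟩
  have h3 : ((n + ⌊n * (a - 1)⌋₊ : ℕ) : ℝ) ≤ (⌈a⌉₊ * n : ℕ) := by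
    push_cast
    have := mul_le_mul_of_nonneg_right (Nat.le_ceil a) hn0
    linarith
  exact_mod_cast h3

lemma eventually_le_freeCount {s e : ℕ → ℕ} (hs : StrictMono s) (hle : ∀ k, s k ≤ e k)
    (hse : ∀ k, (k + 1) * e k ≤ s (k + 1)) {δ r : ℝ} (hδ : 1 ≤ δ)
    (he : ∀ k, (e k : ℝ) ≤ δ * s k + 1) (hr : r < 1 / δ) :
    ∀ᶠ N : ℕ in atTop, r * N - 3 ≤ freeCount (blockFree s e) 0 N := by
  have hδ0 : 0 < δ := by linarith
  obtain ⟨M, hM⟩ := exists_nat_gt (max (2 * δ) (1 / (1 / δ - r)))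
  have hM1 : 2 * δ < M := (le_max_left _ _).trans_lt hM
  have hM2 : 1 / (1 / δ - r) < M := (le_max_right _ _).trans_lt hM
  have hM0 : (0 : ℝ) < M := by linarith
  have hM0' : 0 < M := by exact_mod_cast hM0
  have hM3 : 1 / (M : ℝ) ≤ 1 / δ - r := by
    have h0 : 0 < 1 / δ - r := by linarith
    rw [div_lt_iff₀ h0] at hM2
    rw [div_le_iff₀ hM0]; linarith
  obtain ⟨n₀, hn₀⟩ := exists_unique_block hs hle hse M 0
  filter_upwards [eventually_ge_atTop (M * n₀), eventually_ge_atTop ⌈2 * δ⌉₊] with N hN1 hN2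
  have hN2' : 2 * δ ≤ N := Nat.ceil_le.1 hN2
  set n := N / M + 1 with hn
  have hn1 : n₀ ≤ n := by
    have : n₀ ≤ N / M := (Nat.le_div_iff_mul_le hM0').2 (by rwa [mul_comm] at hN1)
    omega
  have hnN : N ≤ M * n := (Nat.lt_mul_div_succ N hM0').le
  have hnr : (n : ℝ) ≤ N / M + 1 := by
    rw [hn]; push_cast
    linarith [@Nat.cast_div_le ℝ _ _ _ N M]
  have hn0 : (0 : ℝ) < n := by rw [hn]; positivity
  have hNM : (N : ℝ) / M ≤ N / (2 * δ) := by gcongr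
  have hnδ : n * δ ≤ N := by
    have h1 : n * δ ≤ (N / (2 * δ) + 1) * δ := by
      refine mul_le_mul_of_nonneg_right (by linarith) hδ0.le
    have h2 : ((N : ℝ) / (2 * δ) + 1) * δ = N / 2 + δ := by field_simp
    linarith
  obtain ⟨k, -, hk⟩ := hn₀ n hn1 N hnN
  have hε : 0 ≤ (N : ℝ) / n - δ := by
    rw [sub_nonneg, le_div_iff₀ hn0]; linarith
  have hmain := freeCount_ge_of_ratio_le hδ hε hk (he k) (by
    rw [add_sub_cancel, mul_div_cancel₀ _ hn0.ne']; linarith)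
  have h1 : ((N : ℝ) / n - δ) / δ * n = N / δ - n := by field_simp
  have h2 : (freeCount (blockFree s e) n N : ℝ) ≤ freeCount (blockFree s e) 0 N := by
    exact_mod_cast freeCount_mono (Nat.zero_le n)
  have h3 : (N : ℝ) * (1 / M) ≤ N * (1 / δ - r) := by gcongr
  have h4 : (N : ℝ) / δ = N * (1 / δ) := by ring
  have h5 : (N : ℝ) / M = N * (1 / M) := by ring
  nlinarith

lemma dimH_setOf_add_eq (E : Set ℝ) (y : ℝ) : dimH {z | z + y ∈ E} = dimH E := by
  have : E = (IsometryEquiv.addRight y) '' {z | z + y ∈ E} := by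
    ext x
    simp only [mem_image, mem_ofPred_eq, IsometryEquiv.addRight_apply]
    exact ⟨fun hx => ⟨x - y, by simpa using hx, by simp⟩, by rintro ⟨z, hz, rfl⟩; exact hz⟩
  conv_rhs => rw [this]
  rw [IsometryEquiv.dimH_image]

theorem le_dimH_of_hasApproxExponent {b : ℕ} (hb : 2 ≤ b) {x₀ y d₁ d₂ : ℝ} (hd₁ : 1 ≤ d₁)
    (hd : d₁ ≤ d₂) (hx₀ : HasApproxExponent b x₀ (1 / d₁))
    (hz₀ : HasApproxExponent b (x₀ - y) (1 / d₂)) :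
    ENNReal.ofReal (1 / d₂) ≤
      dimH {z | HasApproxExponent b (z + y) (1 / d₁) ∧ HasApproxExponent b z (1 / d₂)} := by
  classical
  have hb0 : (0 : ℝ) < b := by positivity
  have hb1 : (1 : ℝ) ≤ b := by exact_mod_cast (by omega : 1 ≤ b)
  have : NeZero b := ⟨by omega⟩
  have hd₂ : 1 ≤ d₂ := hd₁.trans hd
  set ρ : ℕ → ℝ := fun k => if Even k then d₂ else d₁ with hρ
  have hρ1 : ∀ k, 1 ≤ ρ k := fun k => by simp only [hρ]; split_ifs <;> assumption
  have hρ2 : ∀ k, ρ k ≤ d₂ := fun k => by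
    simp only [hρ]; split_ifs
    · exact le_rfl
    · exact hd
  set A : ℕ → Set ℕ := fun k => {n | Even k → distInt ((b : ℝ) ^ n * (x₀ - y)) ≤
    (b : ℝ) ^ n * (b : ℝ) ^ (-(n * (d₂ - 1 / (k + 1 : ℝ))))} with hA
  have hAinf : ∀ k, (A k).Infinite := fun k => by
    have h := (approximable_iff hb _ _).1 (hz₀.approximable hb
      (show d₂ - 1 / (k + 1 : ℝ) < d₂ by
        have : (0 : ℝ) < 1 / (k + 1 : ℝ) := by positivity
        linarith))
    exact h.mono fun n hn _ => hn
  obtain ⟨s, hs⟩ := exists_sparse_seq hAinf fun k n => (k + 1) * ⌈ρ k * n⌉₊ + n + 1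
  set e : ℕ → ℕ := fun k => ⌈ρ k * s k⌉₊ with he
  have hse : ∀ k, (k + 1) * e k ≤ s (k + 1) := fun k => by
    have := (hs k).2
    simp only [he]; omega
  have hmono : StrictMono s := strictMono_nat_of_lt_succ fun k => by have := (hs k).2; omega
  have hes : ∀ k, e k ≤ s (k + 1) := fun k =>
    (Nat.le_mul_of_pos_left _ (Nat.succ_pos k)).trans (hse k)
  have hel : ∀ k, s k * ρ k ≤ e k := fun k => by rw [mul_comm]; exact Nat.le_ceil _
  have hle : ∀ k, s k ≤ e k := fun k => by
    have h1 : (s k : ℝ) ≤ s k * ρ k := le_mul_of_one_le_right (by positivity) (hρ1 k)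
    exact_mod_cast h1.trans (hel k)
  have heu : ∀ k, (e k : ℝ) ≤ ρ k * s k + 1 := fun k =>
    (Nat.ceil_lt_add_one (by have := hρ1 k; positivity)).le
  have heu₂ : ∀ k, (e k : ℝ) ≤ d₂ * s k + 1 := fun k => (heu k).trans (by
    have := hρ2 k; gcongr)
  set v : ℕ → Fin b := Real.digits (Int.fract (-y)) b with hv
  have hvy : Real.ofDigits v = Int.fract (-y) :=
    Real.ofDigits_digits (by omega) ⟨Int.fract_nonneg _, Int.fract_lt_one _⟩
  set c : ℕ → Fin b := fun i => if ∃ k, ¬ Even k ∧ s k ≤ i ∧ i < e k then v i else 0 with hc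
  obtain ⟨μ, hμp, hμ, hμc⟩ := exists_cantor_measure hb (blockFree s e) c
  have hblock : ∀ k, ∀ i ∈ Finset.Ico (s k) (s k + (e k - s k)), s k ≤ i ∧ i < e k :=
    fun k i hi => by
      rw [Finset.mem_Ico] at hi
      have := hle k
      omega
  have heven : ∀ k, Even k → ∀ᵐ z ∂μ,
      distInt ((b : ℝ) ^ s k * z) ≤ (b : ℝ) ^ s k * (b : ℝ) ^ (-(s k * d₂)) := fun k hk => by
    have h := hμc (fun _ => 0) (s k) (e k - s k) fun i hi => by
      have hi' := hblock k i hi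
      refine ⟨fun h => h k hi', ?_⟩
      simp only [hc]
      rw [if_neg]
      rintro ⟨j, hj, hj'⟩
      rw [block_index_unique hmono hes hj' hi'] at hj
      exact hj hk
    have h0 : Real.ofDigits (fun _ => (0 : Fin b)) = 0 := by
      simp [Real.ofDigits, Real.ofDigitsTerm]
    filter_upwards [h] with z hz
    rw [h0, sub_zero] at hz
    refine hz.trans (one_div_pow_sub_le hb (hle k) ?_)
    have := hel k
    simpa only [hρ, if_pos hk] using this
  have hodd : ∀ k, ¬ Even k → ∀ᵐ z ∂μ,
      distInt ((b : ℝ) ^ s k * (z + y)) ≤ (b : ℝ) ^ s k * (b : ℝ) ^ (-(s k * d₁)) := fun k hk => by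
    have h := hμc v (s k) (e k - s k) fun i hi => by
      have hi' := hblock k i hi
      exact ⟨fun h => h k hi', by simp only [hc]; rw [if_pos ⟨k, hk, hi'⟩]⟩
    filter_upwards [h] with z hz
    have heq : (b : ℝ) ^ s k * (z - Real.ofDigits v) =
        (b : ℝ) ^ s k * (z + y) + (((b : ℤ) ^ s k * ⌊-y⌋ : ℤ) : ℝ) := by
      rw [hvy, Int.fract]; push_cast; ring
    rw [heq, distInt_add_int] at hz
    refine hz.trans (one_div_pow_sub_le hb (hle k) ?_)
    have := hel k
    simpa only [hρ, if_neg hk] using this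
  have hz_lower : ∀ᵐ z ∂μ, Approximable b d₂ z := by
    have h : ∀ᵐ z ∂μ, ∀ k, Even k → distInt ((b : ℝ) ^ s k * z) ≤
        (b : ℝ) ^ s k * (b : ℝ) ^ (-(s k * d₂)) :=
      ae_all_iff.2 fun k => eventually_imp_distrib_left.2 fun hk => heven k hk
    filter_upwards [h] with z hz
    rw [approximable_iff_frequently hb, frequently_atTop]
    exact fun N => ⟨s (2 * N), by have := hmono.le_apply (x := 2 * N); omega,
      hz _ (even_two_mul N)⟩
  have hx_lower : ∀ᵐ z ∂μ, Approximable b d₁ (z + y) := by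
    have h : ∀ᵐ z ∂μ, ∀ k, ¬ Even k → distInt ((b : ℝ) ^ s k * (z + y)) ≤
        (b : ℝ) ^ s k * (b : ℝ) ^ (-(s k * d₁)) :=
      ae_all_iff.2 fun k => eventually_imp_distrib_left.2 fun hk => hodd k hk
    filter_upwards [h] with z hz
    rw [approximable_iff_frequently hb, frequently_atTop]
    exact fun N => ⟨s (2 * N + 1), by have := hmono.le_apply (x := 2 * N + 1); omega,
      hz _ (by simp)⟩
  have hz_upper : ∀ ε > 0, ∀ᵐ z ∂μ, ¬ Approximable b (d₂ + ε) z := fun ε hε => by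
    have h := ae_not_approximable hb hμ (a := d₂ + ε) (w := 0) (κ := ε / d₂) (C := 2) (by linarith)
      (by positivity) ?_
    · simpa using h
    filter_upwards [exists_block_of_window hmono hle hse (show 1 ≤ d₂ + ε by linarith) 0] with n hn
    obtain ⟨hm, k, -, hk⟩ := hn
    exact Or.inl (freeCount_ge_of_ratio_le hd₂ hε.le hk (heu₂ k) hm)
  have hx_upper : ∀ ε > 0, ∀ᵐ z ∂μ, ¬ Approximable b (d₁ + ε) (z + y) := fun ε hε => by
    have hd₁ε : 0 < d₁ + ε / 4 := by linarith
    set κ := min (min 1 (ε / 4)) (min (ε / d₁) (ε / 4 / (d₁ + ε / 4))) with hκ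
    have hκ0 : 0 < κ := by
      simp only [hκ, lt_min_iff]
      refine ⟨⟨one_pos, ?_⟩, ?_, ?_⟩ <;> positivity
    have hκ1 : κ ≤ 1 := (min_le_left _ _).trans (min_le_left _ _)
    have hκ2 : κ ≤ ε / 4 := (min_le_left _ _).trans (min_le_right _ _)
    have hκ3 : κ ≤ ε / d₁ := (min_le_right _ _).trans (min_le_left _ _)
    have hκ4 : κ * (d₁ + ε / 4) ≤ ε / 4 := by
      rw [← le_div_iff₀ hd₁ε]; exact (min_le_right _ _).trans (min_le_right _ _)
    obtain ⟨K, hK⟩ := exists_nat_one_div_lt (show 0 < ε / 8 by positivity)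
    have hfar := hx₀.not_approximable hd₁ (show d₁ < d₁ + ε / 4 by linarith)
    rw [approximable_iff_frequently hb, not_frequently] at hfar
    obtain ⟨n₁, hn₁⟩ := eventually_atTop.1 hfar
    refine ae_not_approximable hb hμ (κ := κ) (C := 4) (by linarith) hκ0 ?_
    filter_upwards [exists_block_of_window hmono hle hse (show 1 ≤ d₁ + ε by linarith) K,
      eventually_ge_atTop n₁, eventually_ge_atTop ⌈2 / ε⌉₊] with n hn hnn₁ hnε
    obtain ⟨hm, k, hkK, hk⟩ := hn
    have hn0 : (0 : ℝ) ≤ n := by positivity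
    have hnε' : 1 ≤ n * (ε / 2) := by
      have := Nat.ceil_le.1 hnε
      rw [div_le_iff₀ hε] at this; linarith
    by_cases hke : Even k
    · by_cases hcase : n * (1 + κ) < s k ∨ s k * (d₂ - ε / 8) < n * (d₁ + ε / 2) + 2
      · exact Or.inl (freeCount_ge_of_block_end_lt hd₁ hε le_rfl (by positivity) hκ1 hκ2 hk
          (heu₂ k) hm hcase)
      · refine Or.inr ?_
        push Not at hcase
        filter_upwards [heven k hke] with z hz hev
        refine absurd (block_end_lt_of_distInt_le hb (η := ε / 8) (by positivity) hnε' hev hz ?_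
          (not_le.1 (hn₁ _ (hnn₁.trans (le_max_left n (s k))))) ?_) (not_lt.2 hcase.2)
        · refine ((hs k).1 hke).trans ?_
          have h1 : 1 / ((k : ℝ) + 1) ≤ 1 / ((K : ℝ) + 1) := by gcongr
          have h2 : (0 : ℝ) ≤ s k := by positivity
          refine mul_le_mul_of_nonneg_left (Real.rpow_le_rpow_of_exponent_le hb1 ?_) (by positivity)
          nlinarith
        · have h1 : ((max n (s k) : ℕ) : ℝ) ≤ n * (1 + κ) := by
            rw [Nat.cast_max]
            exact max_le (by nlinarith) hcase.1
          calc ((max n (s k) : ℕ) : ℝ) * (d₁ + ε / 4) ≤ n * (1 + κ) * (d₁ + ε / 4) := by gcongr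
            _ = n * (d₁ + ε / 4 + κ * (d₁ + ε / 4)) := by ring
            _ ≤ n * (d₁ + ε / 2) := by
              refine mul_le_mul_of_nonneg_left ?_ hn0
              linarith
    · refine Or.inl ?_
      have hek : (e k : ℝ) ≤ d₁ * s k + 1 := by
        have := heu k
        simpa only [hρ, if_neg hke] using this
      have h1 := freeCount_ge_of_ratio_le hd₁ hε.le hk hek hm
      have h2 : κ * n ≤ ε / d₁ * n := by gcongr
      linarith
  have hj : ∀ j : ℕ, (0 : ℝ) < 1 / (j + 1 : ℝ) := fun j => by positivity
  refine le_dimH_of_measure_closedBall_le hb (μ := μ) ?_ fun r _ hr => ?_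
  · filter_upwards [hz_lower, hx_lower, ae_all_iff.2 fun j : ℕ => hz_upper _ (hj j),
      ae_all_iff.2 fun j : ℕ => hx_upper _ (hj j)] with z h1 h2 h3 h4
    exact ⟨hasApproxExponent_inv hb (by linarith) h2 h4,
      hasApproxExponent_inv hb (by linarith) h1 h3⟩
  · refine ⟨4 * (b : ℝ) ^ (3 : ℝ), by positivity, ?_⟩
    filter_upwards [eventually_le_freeCount hmono hle hse hd₂ heu₂ hr] with N hN x
    refine le_trans (measure_mono fun z hz => ?_) ((hμ (-x) 0 N).trans ?_)
    · rw [Metric.mem_closedBall, Real.dist_eq] at hz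
      refine le_trans (distInt_le _ 0) ?_
      simpa [← sub_eq_add_neg] using hz
    · rw [zero_add]
      exact four_mul_inv_pow_le hb hN

theorem dimH_levelSet_hasApproxExponent {b : ℕ} (hb : 2 ≤ b) {y t₁ t₂ : ℝ} (ht₁ : t₁ ∈ Icc (0 : ℝ) 1)
    (ht₂ : t₂ ∈ Icc (0 : ℝ) 1)
    (hne : {x | HasApproxExponent b x t₁ ∧ HasApproxExponent b (x - y) t₂}.Nonempty) :
    dimH {x | HasApproxExponent b x t₁ ∧ HasApproxExponent b (x - y) t₂} =
      ENNReal.ofReal (min t₁ t₂) := by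
  set E := {x | HasApproxExponent b x t₁ ∧ HasApproxExponent b (x - y) t₂} with hE
  have htrans : dimH {x | HasApproxExponent b (x - y) t₂} = dimH {x | HasApproxExponent b x t₂} :=
    dimH_setOf_add_eq {x | HasApproxExponent b x t₂} (-y)
  refine le_antisymm ?_ ?_
  · rw [ENNReal.ofReal_min]
    refine le_min ((dimH_mono fun x hx => hx.1).trans (dimH_hasApproxExponent_le hb ht₁)) ?_
    refine (dimH_mono (t := {x | HasApproxExponent b (x - y) t₂}) fun x hx => hx.2).trans ?_
    rw [htrans]
    exact dimH_hasApproxExponent_le hb ht₂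
  · obtain ⟨x₀, hx₁, hx₂⟩ := hne
    rcases le_or_gt (min t₁ t₂) 0 with h0 | h0
    · rw [ENNReal.ofReal_eq_zero.2 h0]; exact zero_le
    have h₁ : 0 < t₁ := h0.trans_le (min_le_left _ _)
    have h₂ : 0 < t₂ := h0.trans_le (min_le_right _ _)
    have i₁ : 1 ≤ 1 / t₁ := by rw [le_div_iff₀ h₁]; linarith [ht₁.2]
    have i₂ : 1 ≤ 1 / t₂ := by rw [le_div_iff₀ h₂]; linarith [ht₂.2]
    rcases le_total t₂ t₁ with h | h
    · have key := le_dimH_of_hasApproxExponent hb (x₀ := x₀) (y := y) i₁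
        (one_div_le_one_div_of_le h₂ h) (by rwa [one_div_one_div]) (by rwa [one_div_one_div])
      rw [one_div_one_div, one_div_one_div] at key
      rw [min_eq_right h, ← dimH_setOf_add_eq E y]
      simpa only [hE, mem_ofPred_eq, add_sub_cancel_right] using key
    · have key := le_dimH_of_hasApproxExponent hb (x₀ := x₀ - y) (y := -y) i₂
        (one_div_le_one_div_of_le h₁ h) (by rwa [one_div_one_div])
        (by rwa [one_div_one_div, sub_neg_eq_add, sub_add_cancel])
      rw [one_div_one_div, one_div_one_div] at key
      rw [min_eq_left h]
      refine key.trans (dimH_mono fun x hx => ⟨hx.2, ?_⟩)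
      have := hx.1
      rwa [← sub_eq_add_neg] at this

end LevyBivariate

end

theorem theorem2 (b : ℕ) (hb : 2 ≤ b) (α₁ α₂ : ℝ) (hα₁ : 0 < α₁) (hα₂ : 0 < α₂) (y : ℝ)
    (H₁ H₂ : ℝ)
    (hH : (H₁, H₂) ∈ (Set.Icc 0 α₁ ×ˢ Set.Icc 0 α₂) \ LevyBivariate.regionK b α₁ α₂ y) :
    LevyBivariate.bivariateSpectrum
        (LevyBivariate.levy b α₁) (LevyBivariate.levyShift b α₂ y) H₁ H₂
      = ((min (H₁ / α₁) (H₂ / α₂) : ℝ) : EReal) ∨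
    LevyBivariate.bivariateSpectrum
        (LevyBivariate.levy b α₁) (LevyBivariate.levyShift b α₂ y) H₁ H₂ = ⊥ := by
  have h₁ : H₁ ∈ Icc 0 α₁ := hH.1.1
  have h₂ : H₂ ∈ Icc 0 α₂ := hH.1.2
  have ht₁ : H₁ / α₁ ∈ Icc (0 : ℝ) 1 :=
    ⟨div_nonneg h₁.1 hα₁.le, (div_le_one hα₁).2 h₁.2⟩
  have ht₂ : H₂ / α₂ ∈ Icc (0 : ℝ) 1 :=
    ⟨div_nonneg h₂.1 hα₂.le, (div_le_one hα₂).2 h₂.2⟩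
  rw [LevyBivariate.bivariateSpectrum, LevyBivariate.levelSet_levy_eq hb hα₁ hα₂ y h₁ h₂,
    LevyBivariate.hausdorffDim]
  split_ifs with hE
  · exact Or.inr rfl
  · left
    rw [LevyBivariate.dimH_levelSet_hasApproxExponent hb ht₁ ht₂ (nonempty_iff_ne_empty.2 hE),
      EReal.coe_ennreal_ofReal, max_eq_left (le_min ht₁.1 ht₂.1)]
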